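/- Let $q,k\ge 2$ and $n\ge k$ be integers. A $q$-ary $(k,n)$-strongly selective code of length $t$ is a $t\times n$ matrix with entries in $\{0,\dots,q-1\}$ such that for any $k$ distinct columns and any column $\mathbf c$ among them there is a row in which $\mathbf c$ has a nonzero entry $s$ while the other $k-1$ columns have entries different from $s$. It is a $q$-ary $(k,w,n)$-strongly selective code if moreover every column has exactly $w$ nonzero entries. Put $$w=\lceil 1+(k-1)\ln(2en)\rceil,\qquad \lambda=\Big\lfloor\frac{w-1}{k-1}\Big\rfloor,\qquad D=\max\{2n-4,1\},$$ $$t=\max\Big\{2w-(\lambda+1),\ \Big\lceil \frac{\lambda}{2}+\frac{1}{q-1}\cdot\frac{ew}{\lambda+1}\Big(w-\frac{\lambda}{2}\Big)(eD)^{1/(\lambda+1)}\Big\rceil\Big\}.$$ Consider the following randomized resampling algorithm. Draw the $n$ columns of a $t\times n$ matrix independently and uniformly among the vectors in $\{0,\dots,q-1\}^t$ with exactly $w$ nonzero entries, and put all pairs of columns on a stack. While the stack is not empty, remove its top pair and check it: if the two columns have the same nonzero entry in more than $\lambda$ rows, draw both columns anew and put all pairs that contain at least one of them on the stack. When the stack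 is empty, output the matrix. Random columns are drawn row by row, and pairs are checked row by row; each uniform draw of an integer, each row processed and each pair handled on the stack counts as a bounded number of elementary operations. Then there is an absolute constant $C$ such that for all such $q,k,n$: the algorithm stops with probability one; whenever it stops, its output is a $q$-ary $(k,w,n)$-strongly selective code (in particular a $q$-ary $(k,n)$-strongly selective code) of length $t$; its expected number of elementary operations is at most $C\,t\,n^2$; and $$t\le\max\Big\{2(k-1)\ln(2en)-\ln n,\ \ \frac{\ln n}{2}+\frac{e^2(k-1)^2}{q-1}\ln(2en)+\frac{7e^2(k-1)}{2(q-1)}\Big\}+C .$$ -/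

import Mathlib

namespace SelectiveCode

/-! ### Codes -/

/-- A `q`-ary `(k, n)`-strongly selective code of length `t`: a `t × n` matrix with entries in
`{0, …, q - 1}` such that for every set `S` of `k` columns and every column `c` of `S` some row `i`
has a nonzero symbol in column `c` which differs from the symbols of the other columns of `S`. -/
def IsStronglySelective (q k : ℕ) {t n : ℕ} (M : Matrix (Fin t) (Fin n) ℕ) : Prop :=
  (∀ i j, M i j < q) ∧
    ∀ S : Finset (Fin n), S.card = k → ∀ c ∈ S,
      ∃ i, M i c ≠ 0 ∧ ∀ d ∈ S, d ≠ c → M i d ≠ M i c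

/-- A `q`-ary `(k, w, n)`-strongly selective code: moreover every column has exactly `w` nonzero
components. -/
def IsStronglySelectiveOfWeight (q k w : ℕ) {t n : ℕ} (M : Matrix (Fin t) (Fin n) ℕ) : Prop :=
  IsStronglySelective q k M ∧
    ∀ j, (Finset.univ.filter fun i => M i j ≠ 0).card = w

/-! ### Randomized programs that count their elementary operations -/

/-- A randomized program with result in `α`: the joint law of its result and of the number of
elementary operations that it has executed. -/
def Prog (α : Type) : Type := PMF (α × ℕ)

namespace Prog

/-- The joint law of result and operation count. -/
def law {α : Type} (p : Prog α) : PMF (α × ℕ) := p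

/-- Sequential composition runs `p`, then `f` on its result; the operation counts add up. -/
noncomputable instance : Monad Prog where
  pure a := PMF.pure (a, 0)
  bind p f := PMF.bind p fun x => PMF.map (fun y => (y.1, x.2 + y.2)) (f x.1)

/-- Charge `c` elementary operations. -/
noncomputable def tick (c : ℕ) : Prog Unit := PMF.pure ((), c)

/-- Draw an integer uniformly at random from `{0, …, m}`; this is one elementary operation. -/
noncomputable def randUpTo (m : ℕ) : Prog ℕ :=
  PMF.map (fun u : Fin (m + 1) => ((u : ℕ), 1)) (PMF.uniformOfFintype (Fin (m + 1)))

/-- The expected number of elementary operations of a program. -/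
noncomputable def expectedCost {α : Type} (p : Prog α) : ENNReal :=
  ∑' x : α × ℕ, p.law x * (x.2 : ENNReal)

end Prog

open Prog

/-! ### The resampling algorithm -/

/-- Draw a uniformly random `q`-ary column of length `t` with exactly `w` nonzero entries (for
`w ≤ t` and `2 ≤ q`), row by row: if `w` of the remaining `t + 1` rows are still to be made nonzero,
then the next row is nonzero with probability `w / (t + 1)`, and its symbol is then uniform in
`{1, …, q - 1}`. -/
noncomputable def drawColumn (q : ℕ) : (t w : ℕ) → Prog (Fin t → ℕ)
  | 0, _ => pure Fin.elim0
  | t + 1, w => do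
    tick 1
    let u ← randUpTo t
    if u < w then
      let s ← randUpTo (q - 2)
      let c ← drawColumn q t (w - 1)
      pure (Fin.cons (s + 1) c)
    else
      let c ← drawColumn q t w
      pure (Fin.cons 0 c)

/-- Draw `n` independent columns. -/
noncomputable def drawColumns (q t w : ℕ) : (n : ℕ) → Prog (Fin n → Fin t → ℕ)
  | 0 => pure Fin.elim0
  | n + 1 => do
    let c ← drawColumn q t w
    let M ← drawColumns q t w n
    pure (Fin.cons c M)

/-- Count, row by row, the rows in which two columns have the same nonzero entry. -/
noncomputable def countCommon : {t : ℕ} → (c d : Fin t → ℕ) → Prog ℕ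
  | 0, _, _ => pure 0
  | _ + 1, c, d => do
    tick 1
    let r ← countCommon (Fin.tail c) (Fin.tail d)
    if c 0 = d 0 ∧ c 0 ≠ 0 then pure (r + 1) else pure r

/-- All pairs of columns. -/
def allPairs (n : ℕ) : List (Fin n × Fin n) :=
  (List.finRange n).flatMap fun i =>
    (List.finRange n).flatMap fun j => if i < j then [(i, j)] else []

/-- All pairs of columns (each listed once) that contain column `i` or column `j`, for `i ≠ j`. -/
def pairsMeeting {n : ℕ} (i j : Fin n) : List (Fin n × Fin n) :=
  (i, j) :: (List.finRange n).flatMap fun l => if l = i ∨ l = j then [] else [(i, l), (j, l)]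

/-- The memory of the algorithm: the current columns, and a stack that holds the pairs of columns
which remain to be checked. -/
structure State (t n : ℕ) where
  columns : Fin n → Fin t → ℕ
  stack : List (Fin n × Fin n)

/-- The algorithm stops when no pair is left to be checked. -/
def State.Halted {t n : ℕ} (s : State t n) : Prop := s.stack = []

/-- The matrix held in memory. -/
def State.matrix {t n : ℕ} (s : State t n) : Matrix (Fin t) (Fin n) ℕ :=
  Matrix.of fun i j => s.columns j i

/-- Start with independent random columns and with all pairs on the stack. -/
noncomputable def start (q w t n : ℕ) : Prog (State t n) := do
  let M ← drawColumns q t w n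
  tick (n * n)
  pure ⟨M, allPairs n⟩

/-- One round: take a pair from the stack and check it. If its two columns share more than `lam`
nonzero entries, draw both of them anew and put all pairs containing one of them on the stack. -/
noncomputable def step (q w lam : ℕ) {t n : ℕ} (s : State t n) : Prog (State t n) :=
  match s.stack with
  | [] => pure s
  | (i, j) :: rest => do
    tick 1
    let r ← countCommon (s.columns i) (s.columns j)
    if r ≤ lam then
      pure ⟨s.columns, rest⟩
    else
      let c ← drawColumn q t w
      let d ← drawColumn q t w
      tick (2 * n)
      pure ⟨Function.update (Function.update s.columns i c) j d, pairsMeeting i j ++ rest⟩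

/-- `N` rounds of the algorithm (a halted state stays as it is, at no cost). -/
noncomputable def rounds (q w lam t n : ℕ) : ℕ → Prog (State t n)
  | 0 => start q w t n
  | N + 1 => do
    let s ← rounds q w lam t n N
    step q w lam s

/-- The number of common nonzero entries that is allowed for two columns, `⌊(w-1)/(k-1)⌋`. -/
def maxCommon (k w : ℕ) : ℕ := (w - 1) / (k - 1)

/-- The length of the code that the algorithm constructs,
`max {2w - (λ+1), ⌈λ/2 + (1/(q-1)) (e w/(λ+1)) (w - λ/2) (e D)^(1/(λ+1))⌉}` with
`λ = ⌊(w-1)/(k-1)⌋`, where `D = max {2n - 4, 1}` bounds the number of pairs of columns that meet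
a given pair in exactly one column. -/
noncomputable def codeLength (q k w n : ℕ) : ℕ :=
  max (2 * w - (maxCommon k w + 1))
    ⌈(maxCommon k w : ℝ) / 2 + 1 / ((q : ℝ) - 1) *
      (Real.exp 1 * w / ((maxCommon k w : ℝ) + 1) * ((w : ℝ) - (maxCommon k w : ℝ) / 2) *
        (Real.exp 1 * max (2 * (n : ℝ) - 4) 1) ^ (1 / ((maxCommon k w : ℝ) + 1)))⌉₊

/-- The algorithm for `q`-ary `(k, w, n)`-strongly selective codes, run for `N` rounds. -/
noncomputable def algorithm (q k w n N : ℕ) : Prog (State (codeLength q k w n) n) :=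
  rounds q w (maxCommon k w) (codeLength q k w n) n N

/-- The expected number of elementary operations of the algorithm until it stops. As the number of
operations does not decrease with the number of rounds and does not change after the algorithm has
stopped, this is the supremum of the expectations over all numbers of rounds. -/
noncomputable def expectedTime (q k w n : ℕ) : ENNReal :=
  ⨆ N, (algorithm q k w n N).expectedCost

end SelectiveCode

/-! Correctness is a counting argument. The stack always contains every pair sharing more than `λ`
nonzero entries (`invariant_rounds`). When it is empty, the `k - 1` other columns of a `k`-set can
spoil at most `(k - 1) λ ≤ w - 1` of the `w` nonzero entries of a column, so one entry survives.

For the running time, a first moment bound on the number of `(λ + 1)`-sets of common entries,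
together with Stirling's formula, shows that a pair of random columns is bad with probability `p ≤ 1
/ (4 e D)` (`badProb_codeLength_le`). Redrawing both columns of a bad pair restores full
independence: the test depended only on the columns thrown away (`columnsE_resample`). A pair that
passes would condition the columns. This is avoided by an upper bound in which the "passes" branch
is counted for all columns, with no indicator (`stepE_cons_le`). Hence the expectation of a
nonnegative functional from a stack `pair :: rest` and random columns is at most the one from `rest`
plus `p` times the one from `pushed ++ rest`, again with random columns, costs being adjusted.

By induction on the rounds, an exponential moment of the cost is at most its initial value times `y
^ stack size`, whenever `1 + p θ y ^ m ≤ y`; here `m` bounds the number of pushed pairs and `θ` pays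
for a resampling (`columnsE_iterate_stepE_le`). With `p ≤ 1 / (4 e D)` such a `y = 1 + O(1/n)`
exists, and a tangent line inequality turns the exponential moment into the expected cost `O(t n²)`
(`expectedCost_rounds_le`). Termination follows, since every round before stopping costs at least
one operation. -/

namespace SelectiveCode

open scoped ENNReal

/-! ### Expectations and supports of randomized programs -/

namespace Prog

/-- The expectation of a nonnegative function of the result and of the operation count. -/
noncomputable def expect {α : Type} (p : Prog α) (f : α × ℕ → ℝ≥0∞) : ℝ≥0∞ :=
  ∑' x, p.law x * f x

section Expect

variable {α β : Type}

lemma expect_pure (a : α) (f : α × ℕ → ℝ≥0∞) : expect (pure a) f = f (a, 0) := by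
  have h : (pure a : Prog α).law = PMF.pure (a, 0) := rfl
  rw [expect, h, tsum_eq_single (a, 0)]
  · simp [PMF.pure_apply]
  · intro b hb
    simp [PMF.pure_apply, hb]

lemma expect_map {γ : Type} (p : PMF γ) (g : γ → α × ℕ) (f : α × ℕ → ℝ≥0∞) :
    expect (PMF.map g p) f = ∑' x, p x * f (g x) := by
  change ∑' x, (PMF.map g p) x * f x = _
  simp only [PMF.map_apply, ← ENNReal.tsum_mul_right]
  rw [ENNReal.tsum_comm]
  refine tsum_congr fun x => ?_
  rw [tsum_eq_single (g x)]
  · simp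
  · intro b hb
    simp [hb]

lemma expect_bind (p : Prog α) (g : α → Prog β) (f : β × ℕ → ℝ≥0∞) :
    expect (p >>= g) f = expect p fun x => expect (g x.1) fun y => f (y.1, x.2 + y.2) := by
  have h : (p >>= g).law = PMF.bind p.law fun x => PMF.map (fun y => (y.1, x.2 + y.2)) (g x.1).law := rfl
  rw [expect, h]
  simp only [PMF.bind_apply, ← ENNReal.tsum_mul_right]
  rw [ENNReal.tsum_comm, expect]
  refine tsum_congr fun x => ?_
  simp only [mul_assoc]
  rw [ENNReal.tsum_mul_left]
  congr 1
  exact expect_map (g x.1).law _ f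

lemma expect_tick (c : ℕ) (f : Unit × ℕ → ℝ≥0∞) : expect (tick c) f = f ((), c) := by
  have h : (tick c).law = PMF.pure ((), c) := rfl
  rw [expect, h, tsum_eq_single ((), c)]
  · simp [PMF.pure_apply]
  · intro b hb
    simp [PMF.pure_apply, hb]

lemma expect_randUpTo (m : ℕ) (f : ℕ × ℕ → ℝ≥0∞) :
    expect (randUpTo m) f = ∑ u ∈ Finset.range (m + 1), ((m : ℝ≥0∞) + 1)⁻¹ * f (u, 1) := by
  rw [randUpTo, expect_map, tsum_fintype, Finset.sum_range]
  simp [PMF.uniformOfFintype_apply]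

lemma expect_const (p : Prog α) (a : ℝ≥0∞) : expect p (fun _ => a) = a := by
  rw [expect, ENNReal.tsum_mul_right, p.law.tsum_coe, one_mul]

lemma expect_add (p : Prog α) (f g : α × ℕ → ℝ≥0∞) :
    expect p (fun x => f x + g x) = expect p f + expect p g := by
  simp only [expect, mul_add, ENNReal.tsum_add]

lemma expect_const_mul (p : Prog α) (a : ℝ≥0∞) (f : α × ℕ → ℝ≥0∞) :
    expect p (fun x => a * f x) = a * expect p f := by
  simp only [expect, ← ENNReal.tsum_mul_left]
  exact tsum_congr fun x => by ring

lemma expect_mul_const (p : Prog α) (f : α × ℕ → ℝ≥0∞) (a : ℝ≥0∞) :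
    expect p (fun x => f x * a) = expect p f * a := by
  simp only [expect, ← ENNReal.tsum_mul_right, mul_assoc]

lemma expect_comm (p : Prog α) (p' : Prog β) (f : α × ℕ → β × ℕ → ℝ≥0∞) :
    expect p (fun x => expect p' (f x)) = expect p' fun y => expect p fun x => f x y := by
  simp only [expect, ← ENNReal.tsum_mul_left]
  rw [ENNReal.tsum_comm]
  exact tsum_congr fun y => tsum_congr fun x => by ring

lemma expect_mono_support {p : Prog α} {f g : α × ℕ → ℝ≥0∞}
    (h : ∀ x ∈ p.law.support, f x ≤ g x) : expect p f ≤ expect p g := by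
  refine ENNReal.tsum_le_tsum fun x => ?_
  by_cases hx : p.law x = 0
  · simp [hx]
  · gcongr
    exact h x hx

lemma expect_mono {p : Prog α} {f g : α × ℕ → ℝ≥0∞} (h : ∀ x, f x ≤ g x) :
    expect p f ≤ expect p g :=
  expect_mono_support fun x _ => h x

lemma expectedCost_eq_expect (p : Prog α) : p.expectedCost = expect p fun x => (x.2 : ℝ≥0∞) := rfl

lemma mem_support_pure {a : α} {x : α × ℕ} : x ∈ (pure a : Prog α).law.support ↔ x = (a, 0) := by
  change x ∈ (PMF.pure (a, 0)).support ↔ _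
  simp

lemma mem_support_tick {c : ℕ} {x : Unit × ℕ} : x ∈ (tick c).law.support ↔ x = ((), c) := by
  change x ∈ (PMF.pure ((), c)).support ↔ _
  simp

lemma mem_support_randUpTo {m : ℕ} {x : ℕ × ℕ} :
    x ∈ (randUpTo m).law.support ↔ x.1 ≤ m ∧ x.2 = 1 := by
  change x ∈ (PMF.map _ _).support ↔ _
  rw [PMF.mem_support_map_iff]
  simp only [PMF.mem_support_uniformOfFintype, true_and]
  constructor
  · rintro ⟨u, rfl⟩
    exact ⟨Nat.lt_succ_iff.1 u.2, rfl⟩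
  · rintro ⟨h, h'⟩
    exact ⟨⟨x.1, Nat.lt_succ_of_le h⟩, Prod.ext rfl h'.symm⟩

lemma mem_support_bind {p : Prog α} {g : α → Prog β} {z : β × ℕ} :
    z ∈ (p >>= g).law.support ↔
      ∃ x ∈ p.law.support, ∃ y ∈ (g x.1).law.support, z = (y.1, x.2 + y.2) := by
  change z ∈ (PMF.bind p.law fun x => PMF.map (fun y => (y.1, x.2 + y.2)) (g x.1).law).support ↔ _
  simp only [PMF.mem_support_bind_iff, PMF.mem_support_map_iff]
  constructor
  · rintro ⟨x, hx, y, hy, rfl⟩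
    exact ⟨x, hx, y, hy, rfl⟩
  · rintro ⟨x, hx, y, hy, rfl⟩
    exact ⟨x, hx, y, hy, rfl⟩

end Expect

end Prog

open Prog

/-! ### Random columns -/

/-- The number of nonzero entries of a column. -/
def weight {t : ℕ} (c : Fin t → ℕ) : ℕ := (Finset.univ.filter fun i => c i ≠ 0).card

/-- The number of rows in which two columns have the same nonzero entry. -/
def common {t : ℕ} (c d : Fin t → ℕ) : ℕ :=
  (Finset.univ.filter fun i => c i = d i ∧ c i ≠ 0).card

lemma weight_succ {t : ℕ} (c : Fin (t + 1) → ℕ) :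
    weight c = (if c 0 ≠ 0 then 1 else 0) + weight (Fin.tail c) := by
  rw [weight, Fin.card_filter_univ_succ]
  split_ifs <;> simp [weight, Fin.tail, add_comm] <;> congr

lemma common_succ {t : ℕ} (c d : Fin (t + 1) → ℕ) :
    common c d = (if c 0 = d 0 ∧ c 0 ≠ 0 then 1 else 0) + common (Fin.tail c) (Fin.tail d) := by
  rw [common, Fin.card_filter_univ_succ]
  split_ifs <;> simp [common, Fin.tail, add_comm] <;> congr

lemma common_comm {t : ℕ} (c d : Fin t → ℕ) : common c d = common d c := by
  unfold common
  congr 1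
  ext i
  simp only [Finset.mem_filter, Finset.mem_univ, true_and]
  constructor <;> rintro ⟨h, h'⟩ <;> exact ⟨h.symm, h ▸ h'⟩

lemma weight_le {t : ℕ} (c : Fin t → ℕ) : weight c ≤ t :=
  (Finset.card_filter_le _ _).trans (by simp)

lemma mem_support_drawColumn {q : ℕ} (hq : 2 ≤ q) :
    ∀ {t w : ℕ}, w ≤ t → ∀ x ∈ (drawColumn q t w).law.support,
      (∀ i, x.1 i < q) ∧ weight x.1 = w ∧ x.2 ≤ 3 * t
  | 0, w, hw, x, hx => by
    rw [drawColumn, mem_support_pure] at hx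
    subst hx
    exact ⟨fun i => i.elim0, by simp [weight]; omega, by simp⟩
  | t + 1, w, hw, x, hx => by
    rw [drawColumn, mem_support_bind] at hx
    obtain ⟨x₁, h₁, x₂, h₂, rfl⟩ := hx
    rw [mem_support_bind] at h₂
    obtain ⟨u, hu, x₃, h₃, rfl⟩ := h₂
    rw [mem_support_tick] at h₁
    rw [mem_support_randUpTo] at hu
    subst h₁
    split_ifs at h₃ with huw
    · rw [mem_support_bind] at h₃
      obtain ⟨s, hs, x₄, h₄, rfl⟩ := h₃
      rw [mem_support_bind] at h₄
      obtain ⟨c, hc, x₅, h₅, rfl⟩ := h₄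
      rw [mem_support_pure] at h₅
      rw [mem_support_randUpTo] at hs
      subst h₅
      obtain ⟨hc₁, hc₂, hc₃⟩ := mem_support_drawColumn hq (by omega) c hc
      refine ⟨fun i => ?_, ?_, ?_⟩
      · refine Fin.cases ?_ (fun i => ?_) i
        · simp only [Fin.cons_zero]; omega
        · simpa using hc₁ i
      · simp only [weight_succ, Fin.cons_zero, Fin.tail_cons, hc₂]
        simp only [ne_eq, Nat.add_eq_zero_iff, one_ne_zero, and_false, not_false_eq_true, if_true]
        omega
      · simp only; omega
    · rw [mem_support_bind] at h₃
      obtain ⟨c, hc, x₅, h₅, rfl⟩ := h₃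
      rw [mem_support_pure] at h₅
      subst h₅
      obtain ⟨hc₁, hc₂, hc₃⟩ := mem_support_drawColumn hq (by omega) c hc
      refine ⟨fun i => ?_, ?_, ?_⟩
      · refine Fin.cases ?_ (fun i => ?_) i
        · simp only [Fin.cons_zero]; omega
        · simpa using hc₁ i
      · simp [weight_succ, hc₂]
      · simp only; omega

lemma mem_support_drawColumns {q : ℕ} (hq : 2 ≤ q) {t w : ℕ} (hw : w ≤ t) :
    ∀ {n : ℕ}, ∀ x ∈ (drawColumns q t w n).law.support,
      (∀ j i, x.1 j i < q) ∧ (∀ j, weight (x.1 j) = w) ∧ x.2 ≤ 3 * t * n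
  | 0, x, hx => by
    rw [drawColumns, mem_support_pure] at hx
    subst hx
    exact ⟨fun i => i.elim0, fun i => i.elim0, by simp⟩
  | n + 1, x, hx => by
    rw [drawColumns, mem_support_bind] at hx
    obtain ⟨c, hc, x₂, h₂, rfl⟩ := hx
    rw [mem_support_bind] at h₂
    obtain ⟨M, hM, x₃, h₃, rfl⟩ := h₂
    rw [mem_support_pure] at h₃
    subst h₃
    obtain ⟨hc₁, hc₂, hc₃⟩ := mem_support_drawColumn hq hw c hc
    obtain ⟨hM₁, hM₂, hM₃⟩ := mem_support_drawColumns hq hw M hM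
    refine ⟨fun j => ?_, fun j => ?_, ?_⟩
    · exact Fin.cases (by simpa using hc₁) (fun i => by simpa using hM₁ i) j
    · exact Fin.cases (by simpa using hc₂) (fun i => by simpa using hM₂ i) j
    · simp only; nlinarith

/-- The check involves no randomness and always reads all rows, so it can be replaced by its value
and a fixed charge. -/
lemma countCommon_eq : ∀ {t : ℕ} (c d : Fin t → ℕ),
    countCommon c d = (do tick t; pure (common c d) : Prog ℕ)
  | 0, c, d => by
    refine PMF.ext fun x => ?_
    change (PMF.pure (0, 0)) x = (PMF.bind (PMF.pure ((), 0)) fun x =>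
      PMF.map (fun y => (y.1, x.2 + y.2)) (PMF.pure (common c d, 0))) x
    simp [PMF.pure_bind, PMF.pure_map, common]
  | t + 1, c, d => by
    have h : countCommon c d = (do
        tick 1
        let r ← countCommon (Fin.tail c) (Fin.tail d)
        if c 0 = d 0 ∧ c 0 ≠ 0 then pure (r + 1) else pure r : Prog ℕ) := rfl
    rw [h, countCommon_eq, common_succ]
    change PMF.bind (PMF.pure ((), 1)) (fun x => PMF.map (fun y => (y.1, x.2 + y.2))
        (PMF.bind (PMF.bind (PMF.pure ((), t)) fun x => PMF.map (fun y => (y.1, x.2 + y.2))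
          (PMF.pure (common (Fin.tail c) (Fin.tail d), 0))) fun x =>
            PMF.map (fun y => (y.1, x.2 + y.2)) (if c 0 = d 0 ∧ c 0 ≠ 0 then
              PMF.pure (x.1 + 1, 0) else PMF.pure (x.1, 0)))) =
      PMF.bind (PMF.pure ((), t + 1)) fun x => PMF.map (fun y => (y.1, x.2 + y.2))
        (PMF.pure (_, 0))
    split_ifs <;> simp [PMF.pure_bind, PMF.pure_map, add_comm]

/-- The expectation of a function of a random column. -/
noncomputable def columnE (q t w : ℕ) (f : (Fin t → ℕ) → ℝ≥0∞) : ℝ≥0∞ :=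
  expect (drawColumn q t w) fun x => f x.1

/-- The expectation of a function of `n` independent random columns. -/
noncomputable def columnsE (q t w n : ℕ) (f : (Fin n → Fin t → ℕ) → ℝ≥0∞) : ℝ≥0∞ :=
  expect (drawColumns q t w n) fun x => f x.1

lemma columnsE_succ (q t w n : ℕ) (f : (Fin (n + 1) → Fin t → ℕ) → ℝ≥0∞) :
    columnsE q t w (n + 1) f =
      columnE q t w fun c => columnsE q t w n fun M => f (Fin.cons c M : Fin (n + 1) → Fin t → ℕ) := by
  simp only [columnsE, columnE, drawColumns, expect_bind, expect_pure]

/-- Replacing a column by a fresh one leaves the law of the columns unchanged, and makes them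
independent of the column that has been removed. -/
lemma columnsE_update (q t w : ℕ) : ∀ {n : ℕ} (i : Fin n)
    (h : (Fin t → ℕ) → (Fin n → Fin t → ℕ) → ℝ≥0∞),
    (columnsE q t w n fun M => columnE q t w fun c => h (M i) (Function.update M i c)) =
      columnE q t w fun c => columnsE q t w n fun M => h c M
  | n + 1, i, h => by
    simp only [columnsE_succ]
    induction i using Fin.cases with
    | zero =>
      simp only [Fin.cons_zero, Fin.update_cons_zero]
      refine congrArg (columnE q t w) (funext fun c => ?_)
      exact expect_comm _ _ fun M d => h c (Fin.cons d.1 M.1)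
    | succ i =>
      simp only [Fin.cons_succ, ← Fin.cons_update]
      have := fun c => columnsE_update q t w i fun x M => h x (Fin.cons c M)
      simp only [this]
      exact expect_comm _ _ fun c d => columnsE q t w n fun M => h d.1 (Fin.cons c.1 M)

/-- The probability that two independent random columns share more than `lam` nonzero entries. -/
noncomputable def badProb (q t w lam : ℕ) : ℝ≥0∞ :=
  columnE q t w fun c => columnE q t w fun d => if common c d ≤ lam then 0 else 1

/-- The badness test reads only the two columns that are discarded. Applying `columnsE_update` at
`i` and then at `j` separates them from the new matrix, so the expectation factors. -/
lemma columnsE_resample (q t w lam : ℕ) {n : ℕ} {i j : Fin n} (hij : i ≠ j)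
    (g : (Fin n → Fin t → ℕ) → ℝ≥0∞) :
    (columnsE q t w n fun M => (if common (M i) (M j) ≤ lam then 0 else 1) *
      columnE q t w fun c => columnE q t w fun d =>
        g (Function.update (Function.update M i c) j d)) =
      badProb q t w lam * columnsE q t w n g := by
  have h := columnsE_update q t w i fun x N =>
    (if common x (N j) ≤ lam then 0 else 1) * columnE q t w fun d => g (Function.update N j d)
  simp only [Function.update_of_ne hij.symm] at h
  have h₂ := fun c => columnsE_update q t w j fun x N => (if common c x ≤ lam then 0 else 1) * g N
  have e₁ : ∀ (a : ℝ≥0∞) (f : (Fin t → ℕ) → ℝ≥0∞),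
      (columnE q t w fun c => a * f c) = a * columnE q t w f := fun a f => expect_const_mul _ _ _
  have e₂ : ∀ (a : ℝ≥0∞) (f : (Fin t → ℕ) → ℝ≥0∞),
      (columnE q t w fun c => f c * a) = columnE q t w f * a := fun a f => expect_mul_const _ _ _
  have e₃ : ∀ (a : ℝ≥0∞) (f : (Fin n → Fin t → ℕ) → ℝ≥0∞),
      (columnsE q t w n fun c => a * f c) = a * columnsE q t w n f := fun a f => expect_const_mul _ _ _
  simp only [e₁, e₂, e₃] at h h₂ ⊢
  rw [h]
  simp only [h₂, e₂, badProb]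

lemma columnE_mono_support {q t w : ℕ} {f g : (Fin t → ℕ) → ℝ≥0∞}
    (h : ∀ x ∈ (drawColumn q t w).law.support, f x.1 ≤ g x.1) :
    columnE q t w f ≤ columnE q t w g :=
  expect_mono_support h

lemma columnE_mono {q t w : ℕ} {f g : (Fin t → ℕ) → ℝ≥0∞} (h : ∀ c, f c ≤ g c) :
    columnE q t w f ≤ columnE q t w g :=
  expect_mono fun x => h x.1

lemma columnE_const (q t w : ℕ) (a : ℝ≥0∞) : (columnE q t w fun _ => a) = a :=
  expect_const _ a

lemma columnE_add (q t w : ℕ) (f g : (Fin t → ℕ) → ℝ≥0∞) :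
    (columnE q t w fun c => f c + g c) = columnE q t w f + columnE q t w g :=
  expect_add _ _ _

/-! ### The probability that a pair is bad -/

/-- The law of a random column, row by row. -/
lemma columnE_succ {q t w : ℕ} (hq : 2 ≤ q) (hw : w ≤ t + 1) (f : (Fin (t + 1) → ℕ) → ℝ≥0∞) :
    columnE q (t + 1) w f =
      ENNReal.ofReal (w / (t + 1)) * (ENNReal.ofReal (1 / ((q : ℝ) - 1)) *
        ∑ s ∈ Finset.range (q - 1), columnE q t (w - 1) fun d => f (Fin.cons (s + 1) d)) +
      ENNReal.ofReal ((t + 1 - w) / (t + 1)) * columnE q t w fun d => f (Fin.cons 0 d) := by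
  have hif : ∀ u, (expect (if u < w then (do
      let s ← randUpTo (q - 2)
      let c ← drawColumn q t (w - 1)
      pure (Fin.cons (s + 1) c))
    else (do
      let c ← drawColumn q t w
      pure (Fin.cons 0 c)) : Prog (Fin (t + 1) → ℕ)) fun x => f x.1) =
    if u < w then (∑ s ∈ Finset.range (q - 2 + 1), (((q - 2 : ℕ) : ℝ≥0∞) + 1)⁻¹ *
        columnE q t (w - 1) fun d => f (Fin.cons (s + 1) d))
      else columnE q t w fun d => f (Fin.cons 0 d) := by
    intro u
    split_ifs <;> simp only [expect_bind, expect_pure, expect_randUpTo, columnE]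
  have hq' : ((((q - 2 : ℕ) : ℝ≥0∞) + 1)⁻¹) = ENNReal.ofReal (1 / ((q : ℝ) - 1)) := by
    have h : ((q - 2 : ℕ) : ℝ≥0∞) + 1 = ENNReal.ofReal ((q : ℝ) - 1) := by
      rw [← Nat.cast_add_one, ← ENNReal.ofReal_natCast]
      congr 1
      have : q - 2 + 1 = q - 1 := by omega
      rw [this, Nat.cast_sub (by omega), Nat.cast_one]
    have hq1 : (2 : ℝ) ≤ q := by exact_mod_cast hq
    rw [h, one_div, ENNReal.ofReal_inv_of_pos (by linarith)]
  have ht' : ((t : ℝ≥0∞) + 1)⁻¹ = ENNReal.ofReal (1 / ((t : ℝ) + 1)) := by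
    rw [one_div, ENNReal.ofReal_inv_of_pos (by positivity), ENNReal.ofReal_add (by positivity)
      (by positivity)]
    simp
  have e : q - 2 + 1 = q - 1 := by omega
  rw [columnE, drawColumn]
  simp only [expect_bind, expect_tick, expect_randUpTo, hif]
  rw [← Finset.mul_sum, ← Finset.sum_filter_add_sum_filter_not _ (fun u => u < w),
    Finset.sum_congr rfl (fun u hu => if_pos (Finset.mem_filter.1 hu).2),
    Finset.sum_congr rfl (fun u hu => if_neg (Finset.mem_filter.1 hu).2),
    Finset.sum_const, Finset.sum_const, ← Finset.mul_sum, hq', ht', e]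
  have h₁ : ((Finset.range (t + 1)).filter fun u => u < w).card = w := by
    have : ((Finset.range (t + 1)).filter fun u => u < w) = Finset.range w := by
      ext u; simp; omega
    rw [this, Finset.card_range]
  have h₂ : ((Finset.range (t + 1)).filter fun u => ¬ u < w).card = t + 1 - w := by
    have : ((Finset.range (t + 1)).filter fun u => ¬ u < w) = Finset.Ico w (t + 1) := by
      ext u; simp; omega
    rw [this, Nat.card_Ico]
  have k₁ : ENNReal.ofReal (1 / ((t : ℝ) + 1)) * (w : ℝ≥0∞) = ENNReal.ofReal (w / (t + 1)) := by
    rw [← ENNReal.ofReal_natCast, ← ENNReal.ofReal_mul (by positivity), one_div_mul_eq_div]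
  have k₂ : ENNReal.ofReal (1 / ((t : ℝ) + 1)) * ((t + 1 - w : ℕ) : ℝ≥0∞) =
      ENNReal.ofReal ((t + 1 - w) / (t + 1)) := by
    rw [← ENNReal.ofReal_natCast, ← ENNReal.ofReal_mul (by positivity), one_div_mul_eq_div,
      Nat.cast_sub hw, Nat.cast_add_one]
  rw [h₁, h₂, mul_add, nsmul_eq_mul, nsmul_eq_mul, ← mul_assoc _ (w : ℝ≥0∞), k₁,
    ← mul_assoc _ ((t + 1 - w : ℕ) : ℝ≥0∞), k₂]

/-- A bound for the probability that a random column agrees with `m` given nonzero entries. -/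
noncomputable def agreeBound (q t w m : ℕ) : ℝ :=
  w.descFactorial m / (t.descFactorial m * ((q : ℝ) - 1) ^ m)

lemma agreeBound_nonneg {q : ℕ} (hq : 2 ≤ q) (t w m : ℕ) : 0 ≤ agreeBound q t w m := by
  have : (2 : ℝ) ≤ q := by exact_mod_cast hq
  have : 0 ≤ (q : ℝ) - 1 := by linarith
  rw [agreeBound]
  positivity

/-- The case where the first row is one of the prescribed entries: it must be nonzero and carry the
right symbol. -/
lemma agreeBound_succ {q : ℕ} (t w m : ℕ) :
    w / (t + 1) * (1 / ((q : ℝ) - 1) * agreeBound q t (w - 1) m) =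
      agreeBound q (t + 1) w (m + 1) := by
  rcases w with _ | w
  · simp [agreeBound]
  · simp only [agreeBound, Nat.succ_descFactorial_succ, Nat.add_sub_cancel, pow_succ]
    push_cast
    rw [div_mul_div_comm, div_mul_div_comm]
    congr 1 <;> ring

/-- The case where the first row is not prescribed: condition on whether it is nonzero. -/
lemma agreeBound_average {q : ℕ} {t w m : ℕ} (hw : w ≤ t + 1) (hm : m ≤ t) :
    w / (t + 1) * agreeBound q t (w - 1) m + (t + 1 - w) / (t + 1) * agreeBound q t w m =
      agreeBound q (t + 1) w m := by
  have h₁ : ((t : ℝ) + 1) * t.descFactorial m = (t + 1 - m) * (t + 1).descFactorial m := by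
    have h := Nat.succ_descFactorial_succ t m
    rw [Nat.descFactorial_succ] at h
    have h' : (((t + 1 - m) * (t + 1).descFactorial m : ℕ) : ℝ) =
      ((t + 1) * t.descFactorial m : ℕ) := by exact_mod_cast h
    rw [Nat.cast_mul, Nat.cast_sub (by omega)] at h'
    push_cast at h'
    linarith
  have h₂ : (w : ℝ) * (w - 1).descFactorial m = (w - m) * w.descFactorial m := by
    rcases w with _ | w
    · rcases m with _ | m <;> simp
    · have h := Nat.succ_descFactorial_succ w m
      rw [Nat.descFactorial_succ] at h
      have h' : (((w + 1 - m) * (w + 1).descFactorial m : ℕ) : ℝ) =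
        ((w + 1) * w.descFactorial m : ℕ) := by exact_mod_cast h
      rcases le_or_gt m (w + 1) with hmw | hmw
      · rw [Nat.cast_mul, Nat.cast_sub hmw] at h'
        push_cast at h' ⊢
        linarith
      · rw [Nat.descFactorial_of_lt hmw, Nat.add_sub_cancel, Nat.descFactorial_of_lt (by omega)]
        simp
  have ht : (0 : ℝ) < t.descFactorial m := by exact_mod_cast Nat.descFactorial_pos.2 hm
  have ht' : (0 : ℝ) < (t + 1).descFactorial m := by
    exact_mod_cast Nat.descFactorial_pos.2 (by omega)
  have hm' : (0 : ℝ) < t + 1 - m := by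
    have : (m : ℝ) ≤ t := by exact_mod_cast hm
    linarith
  simp only [agreeBound, ← div_div, ← mul_div_assoc, ← add_div]
  congr 1
  rw [div_mul_eq_mul_div, div_mul_eq_mul_div, ← add_div, div_div, h₂, h₁,
    div_eq_div_iff (by positivity) (by positivity)]
  ring

/-- The binomial coefficient counts the `m`-sets of common rows, and each `m`-set of nonzero rows of
`c` is matched with probability at most `agreeBound`. The induction on rows replaces the sum over
sets by Pascal's rule. Only an inequality is claimed, because `c` is arbitrary and may contain
symbols outside the alphabet. -/
lemma columnE_choose_common_le {q : ℕ} (hq : 2 ≤ q) :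
    ∀ {t w : ℕ}, w ≤ t → ∀ (m : ℕ) (c : Fin t → ℕ),
      columnE q t w (fun d => ((common c d).choose m : ℝ≥0∞)) ≤
        ENNReal.ofReal ((weight c).choose m * agreeBound q t w m)
  | 0, w, hw, m, c => by
    obtain rfl : w = 0 := by omega
    have h : ∀ d, common c d = 0 := fun d => by simp [common]
    simp only [h, columnE_const]
    rcases m with _ | m
    · simp [agreeBound]
    · simp
  | t + 1, w, hw, m, c => by
    have hq1 : (2 : ℝ) ≤ q := by exact_mod_cast hq
    have hq2 : 0 < (q : ℝ) - 1 := by linarith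
    have hw' : (w : ℝ) ≤ t + 1 := by exact_mod_cast hw
    have hcard : ENNReal.ofReal (1 / ((q : ℝ) - 1)) * ((q - 1 : ℕ) : ℝ≥0∞) = 1 := by
      rw [← ENNReal.ofReal_natCast, ← ENNReal.ofReal_mul (by positivity),
        Nat.cast_sub (by omega), Nat.cast_one, one_div_mul_cancel hq2.ne', ENNReal.ofReal_one]
    -- the contribution of the rows after the first
    have key : ∀ m, ENNReal.ofReal (w / (t + 1)) *
          columnE q t (w - 1) (fun d => ((common (Fin.tail c) d).choose m : ℝ≥0∞)) +
        ENNReal.ofReal ((t + 1 - w) / (t + 1)) *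
          columnE q t w (fun d => ((common (Fin.tail c) d).choose m : ℝ≥0∞)) ≤
        ENNReal.ofReal ((weight (Fin.tail c)).choose m * agreeBound q (t + 1) w m) := by
      intro m
      have h₁ := columnE_choose_common_le hq (show w - 1 ≤ t by omega) m (Fin.tail c)
      have h₂ : ENNReal.ofReal ((t + 1 - w) / (t + 1)) *
          columnE q t w (fun d => ((common (Fin.tail c) d).choose m : ℝ≥0∞)) ≤
          ENNReal.ofReal ((t + 1 - w) / (t + 1)) *
            ENNReal.ofReal ((weight (Fin.tail c)).choose m * agreeBound q t w m) := by
        -- For `w = t + 1` the induction hypothesis is not available, but a zero first row then has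
        -- probability zero.
        rcases Nat.lt_or_ge t w with h | h
        · obtain rfl : w = t + 1 := by omega
          simp
        · gcongr
          exact columnE_choose_common_le hq h m (Fin.tail c)
      have hr₁ := agreeBound_nonneg hq t (w - 1) m
      have hr₂ := agreeBound_nonneg hq t w m
      have hw₂ : 0 ≤ (t + 1 - w : ℝ) / (t + 1) := div_nonneg (by linarith) (by positivity)
      calc _ ≤ ENNReal.ofReal (w / (t + 1)) *
            ENNReal.ofReal ((weight (Fin.tail c)).choose m * agreeBound q t (w - 1) m) +
            ENNReal.ofReal ((t + 1 - w) / (t + 1)) *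
            ENNReal.ofReal ((weight (Fin.tail c)).choose m * agreeBound q t w m) := by gcongr
        _ = ENNReal.ofReal ((weight (Fin.tail c)).choose m *
            (w / (t + 1) * agreeBound q t (w - 1) m +
              (t + 1 - w) / (t + 1) * agreeBound q t w m)) := by
          rw [← ENNReal.ofReal_mul (by positivity), ← ENNReal.ofReal_mul hw₂,
            ← ENNReal.ofReal_add (by positivity) (by positivity)]
          congr 1; ring
        _ ≤ _ := by
          rcases Nat.lt_or_ge t m with h | h
          · rw [Nat.choose_eq_zero_of_lt ((weight_le _).trans_lt h)]
            simp
          · rw [agreeBound_average hw h]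
    rw [columnE_succ hq hw]
    simp only [common_succ, Fin.cons_zero, Fin.tail_cons]
    by_cases hc : c 0 = 0
    · simp only [hc, ne_eq, not_true_eq_false, and_false, if_false, zero_add, weight_succ]
      rw [Finset.sum_const, nsmul_eq_mul, Finset.card_range, ← mul_assoc (ENNReal.ofReal (1 / _)),
        hcard, one_mul]
      exact key m
    · simp only [hc, ne_eq, not_false_eq_true, and_true, if_false, zero_add, if_true,
        weight_succ]
      rcases m with _ | m
      · have h := key 0
        simp only [Nat.choose_zero_right, Nat.cast_one, columnE_const, Finset.sum_const,
          nsmul_eq_mul, Finset.card_range, mul_one, one_mul, hcard] at h ⊢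
        exact h
      have hsum : (∑ s ∈ Finset.range (q - 1), columnE q t (w - 1) fun d =>
          ((((if c 0 = s + 1 then 1 else 0) + common (Fin.tail c) d).choose (m + 1) : ℕ) : ℝ≥0∞)) ≤
          ((q - 1 : ℕ) : ℝ≥0∞) *
            columnE q t (w - 1) (fun d => ((common (Fin.tail c) d).choose (m + 1) : ℝ≥0∞)) +
          columnE q t (w - 1) (fun d => ((common (Fin.tail c) d).choose m : ℝ≥0∞)) := by
        -- Pascal's rule: only the symbol equal to `c 0` yields the extra term with `m` in place of
        -- `m + 1`.
        have h : ∀ s, (columnE q t (w - 1) fun d =>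
            ((((if c 0 = s + 1 then 1 else 0) + common (Fin.tail c) d).choose (m + 1) : ℕ) : ℝ≥0∞))
            = columnE q t (w - 1) (fun d => ((common (Fin.tail c) d).choose (m + 1) : ℝ≥0∞)) +
              if s = c 0 - 1 then
                columnE q t (w - 1) (fun d => ((common (Fin.tail c) d).choose m : ℝ≥0∞))
              else 0 := by
          intro s
          by_cases hs : c 0 = s + 1
          · rw [if_pos hs, if_pos (by omega), ← columnE_add]
            congr 1; funext d
            rw [add_comm 1, Nat.choose_succ_succ', Nat.cast_add, add_comm]
          · rw [if_neg hs, if_neg (by omega), add_zero]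
            simp only [zero_add]
        simp only [h]
        rw [Finset.sum_add_distrib, Finset.sum_const, nsmul_eq_mul, Finset.card_range,
          Finset.sum_ite_eq']
        gcongr
        split_ifs <;> simp
      have hr := agreeBound_nonneg hq t (w - 1) m
      calc _ ≤ ENNReal.ofReal (w / (t + 1)) * (ENNReal.ofReal (1 / ((q : ℝ) - 1)) *
            (((q - 1 : ℕ) : ℝ≥0∞) *
            columnE q t (w - 1) (fun d => ((common (Fin.tail c) d).choose (m + 1) : ℝ≥0∞)) +
            columnE q t (w - 1) (fun d => ((common (Fin.tail c) d).choose m : ℝ≥0∞)))) +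
            ENNReal.ofReal ((t + 1 - w) / (t + 1)) * columnE q t w
              (fun d => ((common (Fin.tail c) d).choose (m + 1) : ℝ≥0∞)) := by gcongr
        _ = (ENNReal.ofReal (w / (t + 1)) *
            columnE q t (w - 1) (fun d => ((common (Fin.tail c) d).choose (m + 1) : ℝ≥0∞)) +
            ENNReal.ofReal ((t + 1 - w) / (t + 1)) *
            columnE q t w (fun d => ((common (Fin.tail c) d).choose (m + 1) : ℝ≥0∞))) +
            ENNReal.ofReal (w / (t + 1)) * (ENNReal.ofReal (1 / ((q : ℝ) - 1)) *
            columnE q t (w - 1) (fun d => ((common (Fin.tail c) d).choose m : ℝ≥0∞))) := by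
          rw [mul_add (ENNReal.ofReal (1 / _)), ← mul_assoc (ENNReal.ofReal (1 / _)), hcard,
            one_mul]
          ring
        _ ≤ ENNReal.ofReal ((weight (Fin.tail c)).choose (m + 1) *
              agreeBound q (t + 1) w (m + 1)) +
            ENNReal.ofReal (w / (t + 1)) * (ENNReal.ofReal (1 / ((q : ℝ) - 1)) *
            ENNReal.ofReal ((weight (Fin.tail c)).choose m * agreeBound q t (w - 1) m)) := by
          gcongr
          · exact key (m + 1)
          · exact columnE_choose_common_le hq (show w - 1 ≤ t by omega) m (Fin.tail c)
        _ = _ := by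
          rw [← ENNReal.ofReal_mul (by positivity), ← ENNReal.ofReal_mul (by positivity),
            ← ENNReal.ofReal_add (mul_nonneg (by positivity) (agreeBound_nonneg hq _ _ _))
              (by positivity), add_comm 1, Nat.choose_succ_succ', ← agreeBound_succ]
          congr 1
          push_cast
          ring

/-- Markov's inequality: a bad pair has at least one `(lam + 1)`-set of common entries. -/
lemma badProb_le {q t w lam : ℕ} (hq : 2 ≤ q) (hw : w ≤ t) :
    badProb q t w lam ≤ ENNReal.ofReal (w.choose (lam + 1) * agreeBound q t w (lam + 1)) := by
  refine (columnE_mono_support fun c hc => ?_).trans (columnE_const q t w _).le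
  have h := columnE_choose_common_le hq hw (lam + 1) c.1
  rw [(mem_support_drawColumn hq hw c hc).2.1] at h
  refine le_trans (columnE_mono fun d => ?_) h
  split_ifs with h'
  · simp
  · exact_mod_cast Nat.choose_pos (by omega)

/-! ### Estimates -/

/-- Pair the factor with index `i` with the one with index `l - i`. Both products of two are a
square centred at `l / 2` minus the same amount, and subtracting it from numerator and denominator
can only lower a ratio that is at most one. -/
lemma descFactorial_div_le {w t l : ℕ} (hl : l < w) (hw : w ≤ t) :
    (w.descFactorial (l + 1) : ℝ) / t.descFactorial (l + 1) ≤
      (((w : ℝ) - l / 2) / (t - l / 2)) ^ (l + 1) := by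
  have hl' : (l : ℝ) + 1 ≤ w := by exact_mod_cast hl
  have hw' : (w : ℝ) ≤ t := by exact_mod_cast hw
  have hl0 : (0 : ℝ) ≤ l := l.cast_nonneg
  have hcast : ∀ u : ℕ, w ≤ u → (u.descFactorial (l + 1) : ℝ) =
      ∏ i ∈ Finset.range (l + 1), ((u : ℝ) - i) := by
    intro u hu
    rw [Nat.descFactorial_eq_prod_range, Nat.cast_prod]
    refine Finset.prod_congr rfl fun i hi => ?_
    rw [Finset.mem_range] at hi
    rw [Nat.cast_sub (by omega)]
  have hR : (w.descFactorial (l + 1) : ℝ) / t.descFactorial (l + 1) =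
      ∏ i ∈ Finset.range (l + 1), ((w : ℝ) - i) / (t - i) := by
    rw [hcast w le_rfl, hcast t hw, Finset.prod_div_distrib]
  have hR' : (w.descFactorial (l + 1) : ℝ) / t.descFactorial (l + 1) =
      ∏ i ∈ Finset.range (l + 1), ((w : ℝ) - l + i) / (t - l + i) := by
    rw [hR, ← Finset.prod_range_reflect]
    refine Finset.prod_congr rfl fun i hi => ?_
    rw [Finset.mem_range] at hi
    rw [Nat.add_sub_cancel, Nat.cast_sub (by omega)]
    congr 1 <;> ring
  have ha : 0 ≤ ((w : ℝ) - l / 2) / (t - l / 2) := div_nonneg (by linarith) (by linarith)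
  -- Squaring allows the product to be multiplied by its own reversal, so no middle factor needs
  -- separate treatment.
  refine le_of_sq_le_sq ?_ (by positivity)
  rw [sq]
  nth_rw 1 [hR]
  rw [hR', ← Finset.prod_mul_distrib, ← pow_mul, mul_comm, pow_mul]
  refine (Finset.prod_le_prod (fun i hi => ?_) fun i hi => ?_).trans
    (Finset.prod_const _).le |>.trans_eq (by rw [Finset.card_range])
  all_goals
    rw [Finset.mem_range, Nat.lt_succ_iff] at hi
    have hi' : (i : ℝ) ≤ l := by exact_mod_cast hi
    have hi0 : (0 : ℝ) ≤ i := i.cast_nonneg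
  · exact mul_nonneg (div_nonneg (by linarith) (by linarith))
      (div_nonneg (by linarith) (by linarith))
  · rw [div_mul_div_comm, div_pow, div_le_div_iff₀ (mul_pos (by linarith) (by linarith))
      (pow_pos (by linarith) 2)]
    have h₁ : ((w : ℝ) - i) * (w - l + i) = (w - l / 2) ^ 2 - (i - l / 2) ^ 2 := by ring
    have h₂ : ((t : ℝ) - i) * (t - l + i) = (t - l / 2) ^ 2 - (i - l / 2) ^ 2 := by ring
    have h₃ : ((w : ℝ) - l / 2) ^ 2 ≤ (t - l / 2) ^ 2 :=
      pow_le_pow_left₀ (by linarith) (by linarith) 2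
    rw [h₁, h₂]
    nlinarith [mul_le_mul_of_nonneg_left h₃ (sq_nonneg ((i : ℝ) - l / 2))]

/-- In Stirling's lower bound, `√(2 π m) ≥ 4` as soon as `m ≥ 3`. This factor `4` is the slack that
the running time analysis spends. -/
lemma four_mul_pow_le_factorial {m : ℕ} (hm : 3 ≤ m) :
    4 * ((m : ℝ) / Real.exp 1) ^ m ≤ m.factorial := by
  refine le_trans ?_ (Stirling.le_factorial_stirling m)
  gcongr
  refine Real.le_sqrt_of_sq_le ?_
  have : (3 : ℝ) ≤ m := by exact_mod_cast hm
  nlinarith [Real.pi_gt_three]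

/-- The hypothesis `ht` says that the base of the `(l + 1)`-th power is at most `(l + 1) / (e X)`
with `X ^ (l + 1) = e D`; Stirling's formula absorbs the rest. -/
lemma choose_mul_agreeBound_le {q t w l : ℕ} {D : ℝ} (hq : 2 ≤ q) (hl : 2 ≤ l) (hlw : l < w)
    (hw : w ≤ t) (hD : 0 < D)
    (ht : (l : ℝ) / 2 + 1 / ((q : ℝ) - 1) * (Real.exp 1 * w / ((l : ℝ) + 1) *
      ((w : ℝ) - l / 2) * (Real.exp 1 * D) ^ (1 / ((l : ℝ) + 1))) ≤ t) :
    w.choose (l + 1) * agreeBound q t w (l + 1) ≤ 1 / (4 * Real.exp 1 * D) := by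
  have hl' : (l : ℝ) + 1 ≤ w := by exact_mod_cast hlw
  have hw' : (w : ℝ) ≤ t := by exact_mod_cast hw
  have hl0 : (0 : ℝ) ≤ l := l.cast_nonneg
  have hq1 : (2 : ℝ) ≤ q := by exact_mod_cast hq
  have hQ : 0 < (q : ℝ) - 1 := by linarith
  have ha : 0 < (w : ℝ) - l / 2 := by linarith
  have hb : 0 < (t : ℝ) - l / 2 := by linarith
  have he := Real.exp_pos 1
  set X := (Real.exp 1 * D) ^ (1 / ((l : ℝ) + 1)) with hX
  have hX0 : 0 < X := Real.rpow_pos_of_pos (by positivity) _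
  have hXm : X ^ (l + 1) = Real.exp 1 * D := by
    rw [hX, ← Real.rpow_natCast, ← Real.rpow_mul (by positivity)]
    push_cast
    rw [one_div_mul_cancel (by positivity), Real.rpow_one]
  have hbase : w * ((w - l / 2) / (t - l / 2)) / ((q : ℝ) - 1) ≤
      ((l : ℝ) + 1) / Real.exp 1 / X := by
    have h : 1 / ((q : ℝ) - 1) * (Real.exp 1 * w / ((l : ℝ) + 1) * ((w : ℝ) - l / 2) * X) ≤
        t - l / 2 := by linarith
    rw [one_div_mul_eq_div, div_le_iff₀ hQ, div_mul_eq_mul_div, div_mul_eq_mul_div,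
      div_le_iff₀ (by positivity)] at h
    rw [← mul_div_assoc, div_div, div_div, div_le_div_iff₀ (by positivity) (by positivity)]
    linarith
  have hfact := four_mul_pow_le_factorial (show 3 ≤ l + 1 by omega)
  push_cast at hfact
  have hf0 : (0 : ℝ) < (l + 1).factorial := by exact_mod_cast Nat.factorial_pos _
  calc w.choose (l + 1) * agreeBound q t w (l + 1)
      = w.choose (l + 1) * ((w.descFactorial (l + 1) : ℝ) / t.descFactorial (l + 1) /
          ((q : ℝ) - 1) ^ (l + 1)) := by rw [agreeBound, div_div]
    _ ≤ (w : ℝ) ^ (l + 1) / (l + 1).factorial *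
          ((((w : ℝ) - l / 2) / (t - l / 2)) ^ (l + 1) / ((q : ℝ) - 1) ^ (l + 1)) := by
        gcongr
        · exact Nat.choose_le_pow_div _ _
        · exact descFactorial_div_le hlw hw
    _ = (w * ((w - l / 2) / (t - l / 2)) / ((q : ℝ) - 1)) ^ (l + 1) / (l + 1).factorial := by
        rw [div_pow _ ((q : ℝ) - 1), mul_pow, ← mul_div_assoc, div_mul_eq_mul_div, div_right_comm]
    _ ≤ (((l : ℝ) + 1) / Real.exp 1 / X) ^ (l + 1) / (l + 1).factorial := by
        gcongr
    _ = (((l : ℝ) + 1) / Real.exp 1) ^ (l + 1) / (l + 1).factorial / (Real.exp 1 * D) := by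
        rw [div_pow _ X, hXm, div_right_comm]
    _ ≤ 1 / 4 / (Real.exp 1 * D) := by
        refine div_le_div_of_nonneg_right ?_ (by positivity)
        rw [div_le_div_iff₀ hf0 (by norm_num)]
        linarith
    _ = _ := by rw [div_div, mul_assoc]

lemma log_two_exp_mul {n : ℕ} (hn : 2 ≤ n) :
    Real.log (2 * Real.exp 1 * n) = 1 + Real.log 2 + Real.log n := by
  have : (0 : ℝ) < n := by exact_mod_cast (by omega : 0 < n)
  rw [Real.log_mul (by positivity) this.ne', Real.log_mul (by norm_num) (Real.exp_pos 1).ne',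
    Real.log_exp]
  ring

lemma two_le_log {n : ℕ} (hn : 2 ≤ n) : 2 ≤ Real.log (2 * Real.exp 1 * n) := by
  have h : Real.log 2 ≤ Real.log n :=
    Real.log_le_log (by norm_num) (by exact_mod_cast hn)
  rw [log_two_exp_mul hn]
  linarith [Real.log_two_gt_d9]

/-! ### The choice of `w`, `λ` and `t` -/

section Parameters

variable {k n w : ℕ}

lemma one_add_le_weight (hw : w = ⌈1 + ((k : ℝ) - 1) * Real.log (2 * Real.exp 1 * n)⌉₊) :
    1 + ((k : ℝ) - 1) * Real.log (2 * Real.exp 1 * n) ≤ w :=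
  hw ▸ Nat.le_ceil _

lemma weight_le_two_add (hk : 2 ≤ k) (hn : 2 ≤ n)
    (hw : w = ⌈1 + ((k : ℝ) - 1) * Real.log (2 * Real.exp 1 * n)⌉₊) :
    (w : ℝ) ≤ 2 + ((k : ℝ) - 1) * Real.log (2 * Real.exp 1 * n) := by
  have hk' : (2 : ℝ) ≤ k := by exact_mod_cast hk
  have hL := two_le_log hn
  have := Nat.ceil_lt_add_one (a := 1 + ((k : ℝ) - 1) * Real.log (2 * Real.exp 1 * n))
    (by nlinarith)
  rw [← hw] at this
  linarith

lemma one_le_weight (hk : 2 ≤ k) (hn : 2 ≤ n)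
    (hw : w = ⌈1 + ((k : ℝ) - 1) * Real.log (2 * Real.exp 1 * n)⌉₊) : 1 ≤ w := by
  have hk' : (2 : ℝ) ≤ k := by exact_mod_cast hk
  have hL := two_le_log hn
  have h := one_add_le_weight hw
  exact_mod_cast (show (1 : ℝ) ≤ w by nlinarith)

/-- This makes `λ + 1 ≥ 3`, as the factorial bound requires. -/
lemma two_le_maxCommon (hk : 2 ≤ k) (hn : 2 ≤ n)
    (hw : w = ⌈1 + ((k : ℝ) - 1) * Real.log (2 * Real.exp 1 * n)⌉₊) : 2 ≤ maxCommon k w := by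
  rw [maxCommon, Nat.le_div_iff_mul_le (by omega)]
  have hk' : (2 : ℝ) ≤ k := by exact_mod_cast hk
  have hL := two_le_log hn
  have h := one_add_le_weight hw
  have h' : ((1 + 2 * (k - 1) : ℕ) : ℝ) ≤ w := by
    push_cast [Nat.cast_sub (show 1 ≤ k by omega)]
    nlinarith
  have : 1 + 2 * (k - 1) ≤ w := by exact_mod_cast h'
  omega

lemma mul_maxCommon_le : (k - 1) * maxCommon k w ≤ w - 1 := Nat.mul_div_le _ _

lemma weight_le_mul_maxCommon (hk : 2 ≤ k) : w ≤ (k - 1) * (maxCommon k w + 1) := by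
  have := Nat.lt_mul_div_succ (w - 1) (show 0 < k - 1 by omega)
  rw [maxCommon]
  omega

lemma maxCommon_lt (hw : 1 ≤ w) : maxCommon k w < w :=
  (Nat.div_le_self _ _).trans_lt (by omega)

lemma weight_le_codeLength (q : ℕ) (hw : 1 ≤ w) : w ≤ codeLength q k w n := by
  have := maxCommon_lt (k := k) hw
  exact le_trans (by omega) (le_max_left _ _)

lemma badProb_codeLength_le {q : ℕ} (hq : 2 ≤ q) (hk : 2 ≤ k) (hn : 2 ≤ n)
    (hw : w = ⌈1 + ((k : ℝ) - 1) * Real.log (2 * Real.exp 1 * n)⌉₊) :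
    badProb q (codeLength q k w n) w (maxCommon k w) ≤
      ENNReal.ofReal (1 / (4 * Real.exp 1 * max (2 * (n : ℝ) - 4) 1)) := by
  have hw1 := one_le_weight hk hn hw
  have hwt := weight_le_codeLength (k := k) (n := n) q hw1
  refine (badProb_le hq hwt).trans (ENNReal.ofReal_le_ofReal ?_)
  refine choose_mul_agreeBound_le hq (two_le_maxCommon hk hn hw) (maxCommon_lt hw1) hwt
    (by positivity) ?_
  refine (Nat.le_ceil _).trans ?_
  exact Nat.cast_le.2 (le_max_right _ _)

/-- Since `λ` is `ln (2 e n)` up to a bounded error, `w / (λ + 1) ≤ k - 1` and the root of `e D` is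
at most `e`. The additive `4` covers all roundings. -/
lemma codeLength_le {q : ℕ} (hq : 2 ≤ q) (hk : 2 ≤ k) (hn : 2 ≤ n)
    (hw : w = ⌈1 + ((k : ℝ) - 1) * Real.log (2 * Real.exp 1 * n)⌉₊) :
    (codeLength q k w n : ℝ) ≤
      max (2 * ((k : ℝ) - 1) * Real.log (2 * Real.exp 1 * n) - Real.log n)
        (Real.log n / 2
          + Real.exp 1 ^ 2 * ((k : ℝ) - 1) ^ 2 / ((q : ℝ) - 1) * Real.log (2 * Real.exp 1 * n)
          + 7 * Real.exp 1 ^ 2 * ((k : ℝ) - 1) / (2 * ((q : ℝ) - 1))) + 4 := by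
  have hw1 := one_le_weight hk hn hw
  have hlw := maxCommon_lt (k := k) hw1
  have hk' : (2 : ℝ) ≤ k := by exact_mod_cast hk
  have hn' : (2 : ℝ) ≤ n := by exact_mod_cast hn
  have hq' : (2 : ℝ) ≤ q := by exact_mod_cast hq
  have hL := two_le_log hn
  have hlog := log_two_exp_mul hn
  have hw₁ := one_add_le_weight hw
  have hw₂ := weight_le_two_add hk hn hw
  have hl₁ : (w : ℝ) ≤ ((k : ℝ) - 1) * (maxCommon k w + 1) := by
    have h := weight_le_mul_maxCommon (w := w) hk
    have h' : (w : ℝ) ≤ ((k - 1) * (maxCommon k w + 1) : ℕ) := by exact_mod_cast h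
    rw [Nat.cast_mul, Nat.cast_sub (by omega)] at h'
    exact_mod_cast h'
  have hl₂ : ((k : ℝ) - 1) * maxCommon k w ≤ w - 1 := by
    have h := mul_maxCommon_le (k := k) (w := w)
    have h' : (((k - 1) * maxCommon k w : ℕ) : ℝ) ≤ ((w - 1 : ℕ) : ℝ) := by exact_mod_cast h
    rw [Nat.cast_mul, Nat.cast_sub (by omega), Nat.cast_sub hw1] at h'
    exact_mod_cast h'
  have hlw' : (maxCommon k w : ℝ) + 1 ≤ w := by exact_mod_cast hlw
  have hsub : ((2 * w - (maxCommon k w + 1) : ℕ) : ℝ) = 2 * w - (maxCommon k w + 1) := by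
    rw [Nat.cast_sub (by omega)]; push_cast; ring
  have hlog2 := Real.log_two_lt_d9
  have hlog2' := Real.log_two_gt_d9
  have he := Real.exp_pos 1
  set L := Real.log (2 * Real.exp 1 * n) with hLdef
  set l : ℝ := (maxCommon k w : ℝ) with hl
  have hl0 : 0 ≤ l := Nat.cast_nonneg _
  -- `L ≤ l + 1 ≤ L + 2`
  have hLl : L ≤ l + 1 := by
    by_contra h
    nlinarith
  have hlL : l ≤ L + 1 := by
    by_contra h
    nlinarith
  rw [codeLength, Nat.cast_max, ← max_add_add_right]
  refine max_le_max ?_ ?_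
  · rw [hsub]
    linarith
  · set Q : ℝ := (q : ℝ) - 1 with hQdef
    have hQ : 0 < Q := by linarith
    have hX : (Real.exp 1 * max (2 * (n : ℝ) - 4) 1) ^ (1 / (l + 1)) ≤ Real.exp 1 := by
      have hbase : Real.exp 1 * max (2 * (n : ℝ) - 4) 1 ≤ 2 * Real.exp 1 * n := by
        have : max (2 * (n : ℝ) - 4) 1 ≤ 2 * n := max_le (by linarith) (by linarith)
        nlinarith
      have hexp : 2 * Real.exp 1 * n = Real.exp L := (Real.exp_log (by positivity)).symm
      calc _ ≤ (2 * Real.exp 1 * n) ^ (1 / (l + 1)) := by gcongr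
        _ = Real.exp (L * (1 / (l + 1))) := by rw [hexp, ← Real.exp_mul]
        _ ≤ _ := by
          gcongr
          rw [mul_one_div]
          exact div_le_one_of_le₀ hLl (by positivity)
    have hA : Real.exp 1 * w / (l + 1) ≤ Real.exp 1 * ((k : ℝ) - 1) := by
      rw [div_le_iff₀ (by positivity)]
      nlinarith
    have hB0 : 0 ≤ (w : ℝ) - l / 2 := by linarith
    have hB : (w : ℝ) - l / 2 ≤ ((k : ℝ) - 1) * L + 7 / 2 := by linarith
    have hk1 : 0 ≤ (k : ℝ) - 1 := by linarith
    have hprod : Real.exp 1 * w / (l + 1) * ((w : ℝ) - l / 2) *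
        (Real.exp 1 * max (2 * (n : ℝ) - 4) 1) ^ (1 / (l + 1)) ≤
        Real.exp 1 * ((k : ℝ) - 1) * (((k : ℝ) - 1) * L + 7 / 2) * Real.exp 1 := by
      gcongr
    have hnn : 0 ≤ l / 2 + 1 / Q * (Real.exp 1 * w / (l + 1) * ((w : ℝ) - l / 2) *
        (Real.exp 1 * max (2 * (n : ℝ) - 4) 1) ^ (1 / (l + 1))) := by positivity
    refine (Nat.ceil_lt_add_one hnn).le.trans ?_
    have hmain : 1 / Q * (Real.exp 1 * w / (l + 1) * ((w : ℝ) - l / 2) *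
        (Real.exp 1 * max (2 * (n : ℝ) - 4) 1) ^ (1 / (l + 1))) ≤
        1 / Q * (Real.exp 1 * ((k : ℝ) - 1) * (((k : ℝ) - 1) * L + 7 / 2) * Real.exp 1) := by
      gcongr
    have heq : 1 / Q * (Real.exp 1 * ((k : ℝ) - 1) * (((k : ℝ) - 1) * L + 7 / 2) * Real.exp 1) =
        Real.exp 1 ^ 2 * ((k : ℝ) - 1) ^ 2 / Q * L
          + 7 * Real.exp 1 ^ 2 * ((k : ℝ) - 1) / (2 * Q) := by
      field_simp
    linarith

end Parameters

/-! ### The output of the algorithm -/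

lemma mem_pairsMeeting {n : ℕ} {i j a b : Fin n} :
    (a, b) ∈ pairsMeeting i j ↔ (a = i ∧ b = j) ∨ ((a = i ∨ a = j) ∧ b ≠ i ∧ b ≠ j) := by
  simp only [pairsMeeting, List.mem_cons, Prod.mk.injEq, List.mem_flatMap, List.mem_finRange,
    true_and]
  constructor
  · rintro (h | ⟨l, hl⟩)
    · exact Or.inl h
    · split_ifs at hl with h
      · simp at hl
      · push Not at h
        simp only [List.mem_cons, Prod.mk.injEq, List.not_mem_nil, or_false] at hl
        rcases hl with ⟨rfl, rfl⟩ | ⟨rfl, rfl⟩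
        · exact Or.inr ⟨Or.inl rfl, h⟩
        · exact Or.inr ⟨Or.inr rfl, h⟩
  · rintro (h | ⟨h, h₁, h₂⟩)
    · exact Or.inl h
    · refine Or.inr ⟨b, ?_⟩
      rw [if_neg (by tauto)]
      rcases h with rfl | rfl <;> simp

lemma mem_allPairs {n : ℕ} {a b : Fin n} : (a, b) ∈ allPairs n ↔ a < b := by
  simp only [allPairs, List.mem_flatMap, List.mem_finRange, true_and]
  constructor
  · rintro ⟨i, j, h⟩
    split_ifs at h with hij
    · simp only [List.mem_singleton, Prod.mk.injEq] at h
      obtain ⟨rfl, rfl⟩ := h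
      exact hij
    · simp at h
  · intro h
    exact ⟨a, b, by simp [h]⟩

/-- The invariant of the algorithm: the columns are `q`-ary of weight `w`, the stack holds pairs of
distinct columns, and every pair with more than `lam` common entries is on the stack. -/
structure Invariant (q w lam : ℕ) {t n : ℕ} (s : State t n) : Prop where
  lt : ∀ j i, s.columns j i < q
  weight_eq : ∀ j, weight (s.columns j) = w
  ne : ∀ a b, (a, b) ∈ s.stack → a ≠ b
  mem : ∀ a b, a ≠ b → lam < common (s.columns a) (s.columns b) →
    (a, b) ∈ s.stack ∨ (b, a) ∈ s.stack

section Run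

variable {q w lam t n : ℕ}

lemma step_nil (M : Fin n → Fin t → ℕ) :
    step q w lam (⟨M, []⟩ : State t n) = pure ⟨M, []⟩ := rfl

lemma step_cons (M : Fin n → Fin t → ℕ) (i j : Fin n) (rest : List (Fin n × Fin n)) :
    step q w lam (⟨M, (i, j) :: rest⟩ : State t n) = (do
      tick 1
      let r ← countCommon (M i) (M j)
      if r ≤ lam then
        pure ⟨M, rest⟩
      else
        let c ← drawColumn q t w
        let d ← drawColumn q t w
        tick (2 * n)
        pure ⟨Function.update (Function.update M i c) j d, pairsMeeting i j ++ rest⟩) := rfl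

lemma invariant_start (hq : 2 ≤ q) (hw : w ≤ t) :
    ∀ x ∈ (start q w t n).law.support, Invariant q w lam x.1 := by
  intro x hx
  rw [start, mem_support_bind] at hx
  obtain ⟨M, hM, x₁, h₁, rfl⟩ := hx
  rw [mem_support_bind] at h₁
  obtain ⟨_, _, x₂, h₂, rfl⟩ := h₁
  rw [mem_support_pure] at h₂
  subst h₂
  obtain ⟨h₁, h₂, -⟩ := mem_support_drawColumns hq hw M hM
  refine ⟨h₁, h₂, fun a b h => ?_, fun a b hab _ => ?_⟩
  · exact (mem_allPairs.1 h).ne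
  · rcases lt_or_gt_of_ne hab with h | h
    · exact Or.inl (mem_allPairs.2 h)
    · exact Or.inr (mem_allPairs.2 h)

/-- A popped pair either is good or is pushed again, and only pairs meeting a redrawn column can
become bad. -/
lemma invariant_step (hq : 2 ≤ q) (hw : w ≤ t) {s : State t n} (hs : Invariant q w lam s) :
    ∀ x ∈ (step q w lam s).law.support, Invariant q w lam x.1 := by
  intro x hx
  obtain ⟨M, _ | ⟨⟨i, j⟩, rest⟩⟩ := s
  · rw [step_nil, mem_support_pure] at hx
    subst hx
    exact hs
  rw [step_cons, countCommon_eq, mem_support_bind] at hx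
  obtain ⟨_, _, x₁, h₁, rfl⟩ := hx
  rw [mem_support_bind] at h₁
  obtain ⟨r, hr, x₂, h₂, rfl⟩ := h₁
  rw [mem_support_bind] at hr
  obtain ⟨_, _, x₃, h₃, rfl⟩ := hr
  rw [mem_support_pure] at h₃
  subst h₃
  obtain ⟨hs₁, hs₂, hs₃, hs₄⟩ := hs
  simp only [List.mem_cons, Prod.mk.injEq] at hs₁ hs₂ hs₃ hs₄
  split_ifs at h₂ with h
  · rw [mem_support_pure] at h₂
    subst h₂
    refine ⟨hs₁, hs₂, fun a b hab => hs₃ a b (Or.inr hab), fun a b hab hbad => ?_⟩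
    rcases hs₄ a b hab hbad with (⟨rfl, rfl⟩ | h') | (⟨rfl, rfl⟩ | h')
    · exact absurd h (not_le.2 hbad)
    · exact Or.inl h'
    · exact absurd h (not_le.2 (common_comm (M a) (M b) ▸ hbad))
    · exact Or.inr h'
  · rw [mem_support_bind] at h₂
    obtain ⟨c, hc, x₄, h₄, rfl⟩ := h₂
    rw [mem_support_bind] at h₄
    obtain ⟨d, hd, x₅, h₅, rfl⟩ := h₄
    rw [mem_support_bind] at h₅
    obtain ⟨_, _, x₆, h₆, rfl⟩ := h₅
    rw [mem_support_pure] at h₆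
    subst h₆
    obtain ⟨hc₁, hc₂, -⟩ := mem_support_drawColumn hq hw c hc
    obtain ⟨hd₁, hd₂, -⟩ := mem_support_drawColumn hq hw d hd
    have hij : i ≠ j := hs₃ i j (Or.inl ⟨rfl, rfl⟩)
    refine ⟨fun l => ?_, fun l => ?_, fun a b hab => ?_, fun a b hab hbad => ?_⟩
    · simp only [Function.update_apply]
      split_ifs
      exacts [hd₁, hc₁, hs₁ l]
    · simp only [Function.update_apply]
      split_ifs
      exacts [hd₂, hc₂, hs₂ l]
    · rcases List.mem_append.1 hab with h' | h'
      · rw [mem_pairsMeeting] at h'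
        rcases h' with ⟨rfl, rfl⟩ | ⟨rfl | rfl, h₁, h₂⟩
        exacts [hij, h₁.symm, h₂.symm]
      · exact hs₃ a b (Or.inr h')
    · simp only [List.mem_append, mem_pairsMeeting]
      -- Pairs touching a redrawn column have just been pushed, in one of the two orders; the
      -- columns of all other pairs are unchanged.
      by_cases hm : a = i ∨ a = j ∨ b = i ∨ b = j
      · by_cases ha : a = i ∨ a = j <;> by_cases hb : b = i ∨ b = j
        · rcases ha with ha | ha <;> rcases hb with hb | hb
          · exact absurd (ha.trans hb.symm) hab
          · exact Or.inl (Or.inl (Or.inl ⟨ha, hb⟩))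
          · exact Or.inr (Or.inl (Or.inl ⟨hb, ha⟩))
          · exact absurd (ha.trans hb.symm) hab
        · exact Or.inl (Or.inl (Or.inr ⟨ha, not_or.1 hb⟩))
        · exact Or.inr (Or.inl (Or.inr ⟨hb, not_or.1 ha⟩))
        · exact absurd (or_assoc.2 hm) (not_or.2 ⟨ha, hb⟩)
      · push Not at hm
        obtain ⟨h₁, h₂, h₃, h₄⟩ := hm
        simp only [Function.update_of_ne h₁, Function.update_of_ne h₂, Function.update_of_ne h₃,
          Function.update_of_ne h₄] at hbad
        rcases hs₄ a b hab hbad with (⟨rfl, rfl⟩ | h') | (⟨rfl, rfl⟩ | h')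
        · exact absurd rfl h₁
        · exact Or.inl (Or.inr h')
        · exact absurd rfl h₂
        · exact Or.inr (Or.inr h')

lemma invariant_rounds (hq : 2 ≤ q) (hw : w ≤ t) :
    ∀ N, ∀ x ∈ (rounds q w lam t n N).law.support, Invariant q w lam x.1
  | 0 => invariant_start hq hw
  | N + 1 => fun x hx => by
    rw [rounds, mem_support_bind] at hx
    obtain ⟨s, hs, y, hy, rfl⟩ := hx
    exact invariant_step hq hw (invariant_rounds hq hw N s hs) y hy

/-- If any two columns of weight `w` share at most `lam` nonzero entries, and `(k - 1) * lam < w`,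
then the code is strongly selective. -/
lemma Invariant.isStronglySelectiveOfWeight {k : ℕ} {s : State t n} (hs : Invariant q w lam s)
    (hhalt : s.Halted) (hlam : (k - 1) * lam < w) :
    IsStronglySelectiveOfWeight q k w s.matrix := by
  refine ⟨⟨fun i j => hs.lt j i, fun S hS c hc => ?_⟩, fun j => hs.weight_eq j⟩
  by_contra hcon
  push Not at hcon
  have hgood : ∀ d, d ≠ c → common (s.columns c) (s.columns d) ≤ lam := by
    intro d hd
    by_contra h
    have hnil : s.stack = [] := hhalt
    have := hs.mem c d hd.symm (not_le.1 h)
    simp [hnil] at this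
  have hsub : (Finset.univ.filter fun i => s.columns c i ≠ 0) ⊆
      (S.erase c).biUnion fun d => Finset.univ.filter fun i =>
        s.columns c i = s.columns d i ∧ s.columns c i ≠ 0 := by
    intro i hi
    obtain ⟨d, hd, hdc, h⟩ := hcon i (Finset.mem_filter.1 hi).2
    exact Finset.mem_biUnion.2 ⟨d, Finset.mem_erase.2 ⟨hdc, hd⟩,
      Finset.mem_filter.2 ⟨Finset.mem_univ _, h.symm, (Finset.mem_filter.1 hi).2⟩⟩
  have h := (Finset.card_le_card hsub).trans
    (Finset.card_biUnion_le_card_mul _ _ lam fun d hd => hgood d (Finset.ne_of_mem_erase hd))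
  rw [Finset.card_erase_of_mem hc, hS] at h
  have hw : (Finset.univ.filter fun i => s.columns c i ≠ 0).card = w := hs.weight_eq c
  omega

/-! ### The running time of the algorithm -/

/-- The expectation of a function of the state and of the operation count after one more round. -/
noncomputable def stepE (q w lam : ℕ) {t n : ℕ} (f : State t n × ℕ → ℝ≥0∞) (x : State t n × ℕ) :
    ℝ≥0∞ :=
  expect (step q w lam x.1) fun y => f (y.1, x.2 + y.2)

/-- `rounds` appends rounds at the end; iterating on functionals instead exposes the first round,
where the columns are still fresh and the stack is known. -/
lemma expect_rounds (f : State t n × ℕ → ℝ≥0∞) (N : ℕ) :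
    expect (rounds q w lam t n N) f = expect (start q w t n) ((stepE q w lam)^[N] f) := by
  induction N generalizing f with
  | zero => rfl
  | succ N ih =>
    rw [rounds, expect_bind, Function.iterate_succ_apply, ← ih]
    rfl

/-- Monotonicity in the operation count. -/
def MonotoneCost (f : State t n × ℕ → ℝ≥0∞) : Prop := ∀ s, Monotone fun c => f (s, c)

lemma MonotoneCost.iterate_stepE {f : State t n × ℕ → ℝ≥0∞} (hf : MonotoneCost f) (N : ℕ) :
    MonotoneCost ((stepE q w lam)^[N] f) := by
  induction N with
  | zero => exact hf
  | succ N ih =>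
    rw [Function.iterate_succ']
    exact fun s c d hcd => expect_mono fun y => ih y.1 (by simpa using hcd)

lemma stepE_nil (f : State t n × ℕ → ℝ≥0∞) (M : Fin n → Fin t → ℕ) (c : ℕ) :
    stepE q w lam f (⟨M, []⟩, c) = f (⟨M, []⟩, c) := by
  simp only [stepE, step_nil, expect_pure, add_zero]

/-- The first term is deliberately kept for bad pairs too: without an indicator the columns in it
stay unconditioned. Drawing a column costs at most `3 * t`, and monotonicity permits charging that
maximum. -/
lemma stepE_cons_le (hq : 2 ≤ q) (hw : w ≤ t) {f : State t n × ℕ → ℝ≥0∞} (hf : MonotoneCost f)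
    (M : Fin n → Fin t → ℕ) (i j : Fin n) (rest : List (Fin n × Fin n)) (c : ℕ) :
    stepE q w lam f (⟨M, (i, j) :: rest⟩, c) ≤
      f (⟨M, rest⟩, c + (t + 1)) + (if common (M i) (M j) ≤ lam then 0 else 1) *
        columnE q t w fun x => columnE q t w fun y =>
          f (⟨Function.update (Function.update M i x) j y, pairsMeeting i j ++ rest⟩,
            c + (t + 1) + (6 * t + 2 * n)) := by
  simp only [stepE, step_cons, countCommon_eq, expect_bind, expect_tick, expect_pure, add_zero]
  by_cases h : common (M i) (M j) ≤ lam
  · simp only [h, if_true, expect_pure, zero_mul, add_zero]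
    exact le_of_eq (by congr 2; omega)
  · simp only [h, if_false, expect_bind, expect_pure, expect_tick, one_mul]
    refine le_trans ?_ le_add_self
    refine expect_mono_support fun x hx => expect_mono_support fun y hy => ?_
    have h₁ := (mem_support_drawColumn hq hw x hx).2.2
    have h₂ := (mem_support_drawColumn hq hw y hy).2.2
    exact hf _ (by omega)

lemma length_pairsMeeting {i j : Fin n} (hij : i ≠ j) :
    (pairsMeeting i j).length + 3 = 2 * n := by
  have h : ∀ l : Fin n, (if l = i ∨ l = j then [] else [(i, l), (j, l)] :
      List (Fin n × Fin n)).length = if l ∈ ({i, j} : Finset (Fin n))ᶜ then 2 else 0 := by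
    intro l
    simp only [Finset.mem_compl, Finset.mem_insert, Finset.mem_singleton]
    split_ifs <;> simp_all
  have hc : (({i, j} : Finset (Fin n))ᶜ).card + 2 = n := by
    have := Finset.card_compl_add_card ({i, j} : Finset (Fin n))
    rwa [Finset.card_pair hij, Fintype.card_fin] at this
  rw [pairsMeeting, List.length_cons, List.length_flatMap]
  simp only [h]
  rw [← Fin.sum_univ_def, Finset.sum_ite_mem, Finset.univ_inter, Finset.sum_const, smul_eq_mul]
  omega

lemma length_allPairs_le : (allPairs n).length ≤ n * n := by
  rw [allPairs, List.length_flatMap]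
  refine (List.sum_le_card_nsmul _ n fun x hx => ?_).trans (by simp)
  obtain ⟨i, -, rfl⟩ := List.mem_map.1 hx
  rw [List.length_flatMap]
  refine (List.sum_le_card_nsmul _ 1 fun x hx => ?_).trans (by simp)
  obtain ⟨j, -, rfl⟩ := List.mem_map.1 hx
  split_ifs <;> simp

/-- A potential that bounds the growth of `φ (cost + (t + 1) * stack size)` in expectation. Each
resampling increases the argument of `φ` by at most `6 * t + 2 * n + (t + 1) * m`, where `m` is the
number of pairs that it puts on the stack. -/
lemma columnsE_iterate_stepE_le (hq : 2 ≤ q) (hw : w ≤ t) {φ : ℕ → ℝ≥0∞} (hφ : Monotone φ)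
    {m : ℕ} (hm : 2 * n ≤ m + 3) {θ y : ℝ≥0∞}
    (hθ : ∀ x, φ (x + (6 * t + 2 * n + (t + 1) * m)) ≤ θ * φ x) (hy1 : 1 ≤ y)
    (hy : 1 + badProb q t w lam * θ * y ^ m ≤ y) (N : ℕ) (l : List (Fin n × Fin n))
    (hl : ∀ a b, (a, b) ∈ l → a ≠ b) (c : ℕ) :
    (columnsE q t w n fun M => (stepE q w lam)^[N] (fun x => φ (x.2 + (t + 1) * x.1.stack.length))
      (⟨M, l⟩, c)) ≤ φ (c + (t + 1) * l.length) * y ^ l.length := by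
  induction N generalizing l c with
  | zero =>
    refine (expect_const _ _).le.trans (le_mul_of_one_le_right' ?_)
    exact one_le_pow₀ hy1
  | succ N ih =>
    set F : State t n × ℕ → ℝ≥0∞ := fun x => φ (x.2 + (t + 1) * x.1.stack.length) with hF
    have hmono : MonotoneCost F := fun s c d hcd => hφ (by simpa using hcd)
    simp only [Function.iterate_succ_apply']
    rcases l with _ | ⟨⟨i, j⟩, rest⟩
    · simp only [stepE_nil]
      exact ih [] hl c
    · have hij : i ≠ j := hl i j (by simp)
      have hlen := length_pairsMeeting hij
      have hrest : ∀ a b, (a, b) ∈ rest → a ≠ b := fun a b h => hl a b (List.mem_cons_of_mem _ h)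
      have hpush : ∀ a b, (a, b) ∈ pairsMeeting i j ++ rest → a ≠ b := by
        intro a b hab
        rcases List.mem_append.1 hab with h' | h'
        · rw [mem_pairsMeeting] at h'
          rcases h' with ⟨rfl, rfl⟩ | ⟨rfl | rfl, h₁, h₂⟩
          exacts [hij, h₁.symm, h₂.symm]
        · exact hrest a b h'
      have hG := hmono.iterate_stepE (q := q) (w := w) (lam := lam) N
      set G := (stepE q w lam)^[N] F with hGdef
      calc (columnsE q t w n fun M => stepE q w lam G (⟨M, (i, j) :: rest⟩, c))
          ≤ columnsE q t w n fun M => G (⟨M, rest⟩, c + (t + 1)) +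
              (if common (M i) (M j) ≤ lam then 0 else 1) *
              columnE q t w fun x => columnE q t w fun y =>
                G (⟨Function.update (Function.update M i x) j y, pairsMeeting i j ++ rest⟩,
                  c + (t + 1) + (6 * t + 2 * n)) :=
            expect_mono fun M => stepE_cons_le hq hw hG M.1 i j rest c
        _ = (columnsE q t w n fun M => G (⟨M, rest⟩, c + (t + 1))) +
              badProb q t w lam * columnsE q t w n fun M =>
                G (⟨M, pairsMeeting i j ++ rest⟩, c + (t + 1) + (6 * t + 2 * n)) := by
            rw [← columnsE_resample q t w lam hij]
            exact expect_add _ _ _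
        -- The charge `t + 1` for the check is paid by the popped pair, so only the draws and the
        -- pushed pairs increase the argument of `φ`.
        _ ≤ φ (c + (t + 1) * (rest.length + 1)) * y ^ rest.length +
              badProb q t w lam * ((θ * φ (c + (t + 1) * (rest.length + 1))) *
                (y ^ m * y ^ rest.length)) := by
            gcongr
            · refine (ih rest hrest _).trans_eq ?_
              congr 2; ring
            · refine (ih _ hpush _).trans ?_
              rw [List.length_append, ← pow_add]
              gcongr
              · refine le_trans (hφ ?_) (hθ _)
                have : (t + 1) * (pairsMeeting i j).length ≤ (t + 1) * m :=
                  Nat.mul_le_mul_left _ (by omega)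
                have e₁ := Nat.mul_add (t + 1) (pairsMeeting i j).length rest.length
                have e₂ := Nat.mul_add (t + 1) rest.length 1
                omega
              · omega
        _ = φ (c + (t + 1) * (rest.length + 1)) * y ^ rest.length *
              (1 + badProb q t w lam * θ * y ^ m) := by ring
        _ ≤ φ (c + (t + 1) * (rest.length + 1)) * y ^ rest.length * y := by gcongr
        _ = _ := by rw [List.length_cons, pow_succ, mul_assoc]

lemma expect_rounds_le (hq : 2 ≤ q) (hw : w ≤ t) {φ : ℕ → ℝ≥0∞} (hφ : Monotone φ)
    {m : ℕ} (hm : 2 * n ≤ m + 3) {θ y : ℝ≥0∞}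
    (hθ : ∀ x, φ (x + (6 * t + 2 * n + (t + 1) * m)) ≤ θ * φ x) (hy1 : 1 ≤ y)
    (hy : 1 + badProb q t w lam * θ * y ^ m ≤ y) (N : ℕ) :
    expect (rounds q w lam t n N) (fun x => φ x.2) ≤
      φ (3 * t * n + n * n + (t + 1) * (n * n)) * y ^ (n * n) := by
  have hmono : MonotoneCost (fun x : State t n × ℕ => φ (x.2 + (t + 1) * x.1.stack.length)) :=
    fun s c d hcd => hφ (by simpa using hcd)
  calc expect (rounds q w lam t n N) (fun x => φ x.2)
      ≤ expect (rounds q w lam t n N) fun x => φ (x.2 + (t + 1) * x.1.stack.length) :=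
        expect_mono fun x => hφ (by omega)
    _ ≤ columnsE q t w n fun M => (stepE q w lam)^[N]
          (fun x => φ (x.2 + (t + 1) * x.1.stack.length))
          (⟨M, allPairs n⟩, 3 * t * n + n * n) := by
        rw [expect_rounds, start]
        simp only [expect_bind, expect_tick, expect_pure, add_zero]
        exact expect_mono_support fun M hM => hmono.iterate_stepE N _
          (Nat.add_le_add_right (mem_support_drawColumns hq hw M hM).2.2 _)
    _ ≤ φ (3 * t * n + n * n + (t + 1) * (allPairs n).length) * y ^ (allPairs n).length :=
        columnsE_iterate_stepE_le hq hw hφ hm hθ hy1 hy N _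
          (fun a b h => (mem_allPairs.1 h).ne) _
    _ ≤ _ := by
        gcongr
        · exact hφ (by gcongr; exact length_allPairs_le)
        · exact length_allPairs_le

/-- As long as the algorithm has not stopped, each round costs at least one operation. -/
lemma expectedCost_rounds_succ_ge (N : ℕ) :
    (rounds q w lam t n N).expectedCost +
        (rounds q w lam t n N).law.toOuterMeasure {x | ¬ x.1.Halted} ≤
      (rounds q w lam t n (N + 1)).expectedCost := by
  classical
  have h₁ : (rounds q w lam t n N).law.toOuterMeasure {x | ¬ x.1.Halted} =
      expect (rounds q w lam t n N) fun x => if x.1.Halted then 0 else 1 := by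
    rw [PMF.toOuterMeasure_apply, expect]
    refine tsum_congr fun x => ?_
    by_cases h : x.1.Halted <;> simp [h]
  rw [h₁, expectedCost_eq_expect, expectedCost_eq_expect, ← expect_add, rounds, expect_bind]
  refine expect_mono fun x => ?_
  obtain ⟨⟨M, _ | ⟨⟨i, j⟩, rest⟩⟩, c⟩ := x
  · simp [step_nil, expect_pure, State.Halted]
  · rw [if_neg (by simp [State.Halted]), step_cons, ← expect_const (step q w lam
      (⟨M, (i, j) :: rest⟩ : State t n)) ((c : ℝ≥0∞) + 1), step_cons]
    refine expect_mono_support fun y hy => ?_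
    rw [mem_support_bind] at hy
    obtain ⟨x₁, h₁, x₂, -, rfl⟩ := hy
    rw [mem_support_tick] at h₁
    subst h₁
    exact_mod_cast (by simp only; omega)

/-- The probabilities of still running sum to at most the bounded expected cost, so they tend to
zero. -/
lemma tendsto_halted {B : ℝ≥0∞} (hB : B ≠ ∞)
    (h : ∀ N, (rounds q w lam t n N).expectedCost ≤ B) :
    Filter.Tendsto (fun N => (rounds q w lam t n N).law.toOuterMeasure {x | x.1.Halted})
      Filter.atTop (nhds 1) := by
  have hsum : ∀ N, ∑ i ∈ Finset.range N,
      (rounds q w lam t n i).law.toOuterMeasure {x | ¬ x.1.Halted} ≤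
      (rounds q w lam t n N).expectedCost := by
    intro N
    induction N with
    | zero => simp
    | succ N ih =>
      rw [Finset.sum_range_succ]
      exact le_trans (by gcongr) (expectedCost_rounds_succ_ge N)
  have hfin : ∑' N, (rounds q w lam t n N).law.toOuterMeasure {x | ¬ x.1.Halted} ≠ ∞ := by
    refine ne_top_of_le_ne_top hB ?_
    rw [ENNReal.tsum_eq_iSup_nat]
    exact iSup_le fun N => (hsum N).trans (h N)
  have h0 := ENNReal.tendsto_atTop_zero_of_tsum_ne_top hfin
  have hcompl : ∀ N, (rounds q w lam t n N).law.toOuterMeasure {x | x.1.Halted} =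
      1 - (rounds q w lam t n N).law.toOuterMeasure {x | ¬ x.1.Halted} := by
    intro N
    have hadd : (rounds q w lam t n N).law.toOuterMeasure {x | x.1.Halted} +
        (rounds q w lam t n N).law.toOuterMeasure {x | ¬ x.1.Halted} = 1 := by
      rw [PMF.toOuterMeasure_apply, PMF.toOuterMeasure_apply, ← ENNReal.tsum_add,
        ← (rounds q w lam t n N).law.tsum_coe]
      refine tsum_congr fun x => ?_
      by_cases h : x.1.Halted <;> simp [h]
    refine ENNReal.eq_sub_of_add_eq ?_ hadd
    exact ne_top_of_le_ne_top ENNReal.one_ne_top (hadd ▸ le_add_self)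
  simp only [hcompl]
  simpa using ENNReal.Tendsto.sub (tendsto_const_nhds (x := (1 : ℝ≥0∞))) h0 (Or.inl (by simp))

end Run

/-! ### From the exponential moment to the expected time -/

lemma expectedCost_rounds_le {q w lam t n : ℕ} (hq : 2 ≤ q) (hn : 2 ≤ n) (hw : w ≤ t) (ht : 1 ≤ t)
    (hbad : badProb q t w lam ≤
      ENNReal.ofReal (1 / (4 * Real.exp 1 * max (2 * (n : ℝ) - 4) 1))) (N : ℕ) :
    (rounds q w lam t n N).expectedCost ≤ ENNReal.ofReal (50 * t * (n : ℝ) ^ 2) := by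
  have hn' : (2 : ℝ) ≤ n := by exact_mod_cast hn
  have ht' : (1 : ℝ) ≤ t := by exact_mod_cast ht
  set D : ℝ := max (2 * (n : ℝ) - 4) 1 with hD
  have hD1 : 1 ≤ D := le_max_right _ _
  have hDn : 2 * (n : ℝ) - 4 ≤ D := le_max_left _ _
  set m : ℕ := 2 * n - 3 with hm
  have hmr : (m : ℝ) = 2 * n - 3 := by
    rw [hm, Nat.cast_sub (by omega)]; push_cast; ring
  set Δ : ℕ := 6 * t + 2 * n + (t + 1) * m with hΔ
  have hΔr : (Δ : ℝ) = 6 * t + 2 * n + (t + 1) * (2 * n - 3) := by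
    rw [hΔ]; push_cast; rw [hmr]
  have hΔ0 : (0 : ℝ) < Δ := by rw [hΔr]; nlinarith
  -- At this scale one resampling multiplies `φ` by `θ = exp (1 / 2) ≤ 2`.
  set B : ℝ := 2 * Δ with hB
  have hB0 : 0 < B := by positivity
  set φ : ℕ → ℝ≥0∞ := fun x => ENNReal.ofReal (Real.exp (x / B)) with hφ
  have hφmono : Monotone φ := fun x y hxy => by
    have : (x : ℝ) ≤ y := by exact_mod_cast hxy
    simp only [hφ]
    gcongr
  have he := Real.exp_pos 1
  have hhalf : Real.exp (1 / 2) ≤ 2 := by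
    have h : Real.exp (1 / 2) ^ 2 = Real.exp 1 := by
      rw [← Real.exp_nat_mul]; norm_num
    have := Real.exp_one_lt_d9
    nlinarith [Real.exp_pos (1 / 2)]
  have hy0 : 0 ≤ 1 / (D + 1) := by positivity
  have hpow : (1 + 1 / (D + 1)) ^ m ≤ Real.exp 1 := by
    calc (1 + 1 / (D + 1)) ^ m ≤ Real.exp (1 / (D + 1)) ^ m := by
          gcongr
          linarith [Real.add_one_le_exp (1 / (D + 1))]
      _ = Real.exp (m * (1 / (D + 1))) := by rw [Real.exp_nat_mul]
      _ ≤ Real.exp 1 := by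
          gcongr
          rw [mul_one_div]
          exact div_le_one_of_le₀ (by linarith) (by linarith)
  have hθ : ∀ x, φ (x + Δ) ≤ ENNReal.ofReal (Real.exp (1 / 2)) * φ x := by
    intro x
    simp only [hφ]
    rw [← ENNReal.ofReal_mul (Real.exp_pos _).le, ← Real.exp_add]
    apply le_of_eq
    congr 2
    push_cast
    rw [hB]
    field_simp
    ring
  -- As `m ≤ D + 1`, the power of `y = 1 + 1 / (D + 1)` is at most `e`. The product is thus at most
  -- `2 e / (4 e D) = 1 / (2 D)`, which is at most `1 / (D + 1)` because `D ≥ 1`.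
  have hy : 1 + badProb q t w lam * ENNReal.ofReal (Real.exp (1 / 2)) *
      ENNReal.ofReal (1 + 1 / (D + 1)) ^ m ≤ ENNReal.ofReal (1 + 1 / (D + 1)) := by
    calc _ ≤ ENNReal.ofReal 1 + ENNReal.ofReal (1 / (4 * Real.exp 1 * D)) *
          ENNReal.ofReal 2 * ENNReal.ofReal (Real.exp 1) := by
          rw [← ENNReal.ofReal_pow (by positivity), ENNReal.ofReal_one]
          gcongr
      _ = ENNReal.ofReal (1 + 1 / (2 * D)) := by
          rw [← ENNReal.ofReal_mul (by positivity), ← ENNReal.ofReal_mul (by positivity),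
            ← ENNReal.ofReal_add (by norm_num) (by positivity)]
          congr 2
          field_simp
          norm_num
      _ ≤ _ := by
          gcongr
          linarith
  have hy1 : 1 ≤ ENNReal.ofReal (1 + 1 / (D + 1)) := by
    rw [ENNReal.one_le_ofReal]; linarith
  have hE := expect_rounds_le hq hw hφmono (show 2 * n ≤ m + 3 by omega) hθ hy1 hy N
  set x₀ : ℕ := 3 * t * n + n * n + (t + 1) * (n * n) with hx₀
  set z : ℝ := x₀ / B + (n * n : ℕ) * (1 / (D + 1)) with hz
  have hZ : φ x₀ * ENNReal.ofReal (1 + 1 / (D + 1)) ^ (n * n) ≤ ENNReal.ofReal (Real.exp z) := by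
    simp only [hφ]
    rw [← ENNReal.ofReal_pow (by positivity), ← ENNReal.ofReal_mul (Real.exp_pos _).le, hz,
      Real.exp_add, Real.exp_nat_mul]
    gcongr
    linarith [Real.add_one_le_exp (1 / (D + 1))]
  have hz0 : 0 ≤ z := by positivity
  -- The tangent to `exp` at `z`, where `exp z` bounds the exponential moment; in expectation this
  -- loses only the summand `B`.
  have hcost : ∀ x : ℕ, (x : ℝ≥0∞) ≤
      ENNReal.ofReal (B * z) + ENNReal.ofReal (B * Real.exp (-z)) * φ x := by
    intro x
    simp only [hφ]
    rw [← ENNReal.ofReal_natCast, ← ENNReal.ofReal_mul (by positivity),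
      ← ENNReal.ofReal_add (by positivity) (by positivity)]
    gcongr
    have h := Real.add_one_le_exp (x / B - z)
    rw [mul_assoc B (Real.exp (-z)), ← Real.exp_add, ← mul_add, neg_add_eq_sub]
    calc (x : ℝ) = B * (x / B) := by field_simp
      _ ≤ _ := by gcongr; linarith
  calc (rounds q w lam t n N).expectedCost
      ≤ expect (rounds q w lam t n N) fun x =>
          ENNReal.ofReal (B * z) + ENNReal.ofReal (B * Real.exp (-z)) * φ x.2 :=
        expect_mono fun x => hcost x.2
    _ = ENNReal.ofReal (B * z) + ENNReal.ofReal (B * Real.exp (-z)) *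
          expect (rounds q w lam t n N) fun x => φ x.2 := by
        rw [expect_add, expect_const, expect_const_mul]
    _ ≤ ENNReal.ofReal (B * z) + ENNReal.ofReal (B * Real.exp (-z)) *
          ENNReal.ofReal (Real.exp z) := by
        gcongr
        exact hE.trans hZ
    _ = ENNReal.ofReal (B * z + B) := by
        rw [← ENNReal.ofReal_mul (by positivity), ← ENNReal.ofReal_add (by positivity)
          (by positivity), mul_assoc B (Real.exp (-z)), ← Real.exp_add, neg_add_cancel, Real.exp_zero, mul_one]
    _ ≤ _ := by
        gcongr
        have hx₀r : (x₀ : ℝ) = 3 * t * n + n * n + (t + 1) * (n * n) := by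
          rw [hx₀]; push_cast; ring
        have hBz : B * z = x₀ + B * ((n : ℝ) * (n / (D + 1))) := by
          rw [hz]
          push_cast
          field_simp
        have hnD : n / (D + 1) ≤ 2 := by
          rw [div_le_iff₀ (by positivity)]
          linarith
        have htn : 1 * (n : ℝ) ≤ t * n := by gcongr
        have hBle : B ≤ 18 * (t * n) := by
          rw [hB, hΔr]
          nlinarith
        have h₁ : B * ((n : ℝ) * (n / (D + 1))) ≤ 18 * (t * n) * (n * 2) := by gcongr
        have h₂ : (t : ℝ) * n * 2 ≤ t * n * n := by gcongr
        have h₃ : 1 * (n : ℝ) * n ≤ t * n * n := by gcongr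
        rw [hBz, hx₀r]
        nlinarith

end SelectiveCode

theorem mainTheorem4 :
    ∃ C : ℝ, ∀ q k n w : ℕ, 2 ≤ q → 2 ≤ k → k ≤ n →
      w = ⌈1 + ((k : ℝ) - 1) * Real.log (2 * Real.exp 1 * n)⌉₊ →
      -- whenever the algorithm stops, it outputs a `(k, w, n)`-strongly selective code
      (∀ N, ∀ x ∈ (SelectiveCode.algorithm q k w n N).law.support,
        x.1.Halted → SelectiveCode.IsStronglySelectiveOfWeight q k w x.1.matrix) ∧
      -- it stops with probability one
      Filter.Tendsto
        (fun N => (SelectiveCode.algorithm q k w n N).law.toOuterMeasure {x | x.1.Halted})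
        Filter.atTop (nhds 1) ∧
      -- after `O(t n²)` elementary operations on average
      SelectiveCode.expectedTime q k w n ≤
        ENNReal.ofReal (C * (SelectiveCode.codeLength q k w n : ℝ) * (n : ℝ) ^ 2) ∧
      -- the length of the code
      (SelectiveCode.codeLength q k w n : ℝ) ≤
        max (2 * ((k : ℝ) - 1) * Real.log (2 * Real.exp 1 * n) - Real.log n)
          (Real.log n / 2
            + Real.exp 1 ^ 2 * ((k : ℝ) - 1) ^ 2 / ((q : ℝ) - 1) * Real.log (2 * Real.exp 1 * n)
            + 7 * Real.exp 1 ^ 2 * ((k : ℝ) - 1) / (2 * ((q : ℝ) - 1))) + C := by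
  -- The running time dictates `50`; the length bound needs only `4`.
  refine ⟨50, fun q k n w hq hk hkn hw => ?_⟩
  have hn : 2 ≤ n := hk.trans hkn
  have hw1 := SelectiveCode.one_le_weight hk hn hw
  have hwt := SelectiveCode.weight_le_codeLength (k := k) (n := n) q hw1
  have hcost := SelectiveCode.expectedCost_rounds_le hq hn hwt (hw1.trans hwt)
    (SelectiveCode.badProb_codeLength_le hq hk hn hw)
  refine ⟨fun N x hx hhalt => ?_, SelectiveCode.tendsto_halted ENNReal.ofReal_ne_top hcost,
    iSup_le hcost, ?_⟩
  · refine (SelectiveCode.invariant_rounds hq hwt N x hx).isStronglySelectiveOfWeight hhalt ?_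
    have := SelectiveCode.mul_maxCommon_le (k := k) (w := w)
    omega
  · exact (SelectiveCode.codeLength_le hq hk hn hw).trans (by gcongr; norm_num)
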